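/- Let $F$ be an algebraic closure of a finite field, let $\mathbb F_q$ be any finite field, let $n\ge 0$, and put $G=\mathrm{GL}_n(\mathbb F_q)$. Let $U\le G$ be the subgroup of upper triangular matrices with all diagonal entries equal to $1$. Let $\psi:\mathbb F_q\to F^\times$ be a character of the additive group of $\mathbb F_q$, which is nontrivial unless $\operatorname{char}F$ divides $q$ (if $\operatorname{char}F\mid q$, the trivial character is the only one, and it is allowed). Define the character $\eta_\psi$ of $U$ by $\eta_\psi(x)=\psi\bigl(\sum_{i=1}^{n-1}x_{i,i+1}\bigr)$, and let $\mathrm{Ind}_U^G\eta_\psi$ be the space of functions $f:G\to F$ with $f(ug)=\eta_\psi(u)f(g)$ for all $u\in U$, $g\in G$, on which $G$ acts by right translation. A Whittaker model of a representation $\pi$ of $G$ over $F$ (with respect to $\psi$) is a subrepresentation of $\mathrm{Ind}_U^G\eta_\psi$ that is isomorphic to $\pi$. Then every irreducible representation $\pi$ of $G$ over $F$ has at most one Whittaker model with respect to $\psi$; moreover $\dim_F\mathrm{Hom}_G(\pi,\mathrm{Ind}_U^G\eta_\psi)\le 1$. This holds in all characteristics, even when $\operatorname{char}F$ divides $q$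 or $|G|$. -/

import Mathlib

noncomputable section

/-- The `(i, i)` entry of a product of two upper triangular matrices. -/
theorem upperTriangular_mul_apply_self {K : Type*} [Field K] {n : ℕ}
    {a b : Matrix (Fin n) (Fin n) K} (ha : ∀ i j, j < i → a i j = 0)
    (hb : ∀ i j, j < i → b i j = 0) (i : Fin n) : (a * b) i i = a i i * b i i := by
  rw [Matrix.mul_apply]
  refine Finset.sum_eq_single i (fun k _ hk => ?_) (by simp)
  rcases lt_or_gt_of_ne hk with h | h
  · rw [ha i k h, zero_mul]
  · rw [hb k i h, mul_zero]

/-- The standard unipotent subgroup `U` of `GL_n(K)`: the invertible matrices which are upper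
triangular with all diagonal entries equal to `1`. -/
def unipotentSubgroup (n : ℕ) (K : Type*) [Field K] : Subgroup (GL (Fin n) K) where
  carrier := {g | (∀ i j : Fin n, j < i → g i j = 0) ∧ ∀ i : Fin n, g i i = 1}
  one_mem' := ⟨fun i j h => by simp [h.ne'], fun i => by simp⟩
  mul_mem' := by
    rintro a b ⟨ha, ha'⟩ ⟨hb, hb'⟩
    refine ⟨fun i j h => ?_, fun i => ?_⟩
    · rw [Units.val_mul, Matrix.mul_apply]
      refine Finset.sum_eq_zero fun k _ => ?_
      rcases lt_or_ge k i with hk | hk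
      · rw [ha i k hk, zero_mul]
      · rw [hb k j (lt_of_lt_of_le h hk), mul_zero]
    · rw [Units.val_mul, upperTriangular_mul_apply_self ha hb, ha', hb', one_mul]
  inv_mem' := by
    rintro a ⟨ha, ha'⟩
    have hinv : ∀ i j : Fin n, j < i → (a⁻¹ : GL (Fin n) K) i j = 0 := by
      intro i j h
      have hA : (a : Matrix (Fin n) (Fin n) K).BlockTriangular id := fun i j h => ha i j h
      have : Invertible (a : Matrix (Fin n) (Fin n) K) := a.invertible
      rw [Matrix.coe_units_inv]
      exact Matrix.blockTriangular_inv_of_blockTriangular hA h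
    refine ⟨hinv, fun i => ?_⟩
    have h := upperTriangular_mul_apply_self ha hinv i
    rw [← Units.val_mul, mul_inv_cancel, ha', one_mul] at h
    rw [← h]; simp

/-- The sum `x_{1,2} + x_{2,3} + ⋯ + x_{n-1,n}` of the entries just above the diagonal. -/
def superdiagonalSum {n : ℕ} {K : Type*} [Field K] (g : GL (Fin n) K) : K :=
  ∑ i : Fin n, if h : (i : ℕ) + 1 < n then g i ⟨i + 1, h⟩ else 0

theorem superdiagonalSum_mul {n : ℕ} {K : Type*} [Field K] (a b : unipotentSubgroup n K) :
    superdiagonalSum ((a * b : unipotentSubgroup n K) : GL (Fin n) K) =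
      superdiagonalSum (a : GL (Fin n) K) + superdiagonalSum (b : GL (Fin n) K) := by
  obtain ⟨a, ha, ha'⟩ := a
  obtain ⟨b, hb, hb'⟩ := b
  unfold superdiagonalSum
  rw [← Finset.sum_add_distrib]
  refine Finset.sum_congr rfl fun i _ => ?_
  split_ifs with h
  · set j : Fin n := ⟨i + 1, h⟩ with hj
    have hij : i ≠ j := by simp [hj, Fin.ext_iff]
    change ((a * b : GL (Fin n) K) : Matrix (Fin n) (Fin n) K) i j = _
    rw [Units.val_mul, Matrix.mul_apply, Fintype.sum_eq_add i j hij, ha', hb', one_mul, mul_one,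
      add_comm]
    rintro k ⟨hki, hkj⟩
    rcases lt_or_ge k i with hk | hk
    · rw [ha i k hk, zero_mul]
    · have : j < k := by
        simp only [ne_eq, Fin.ext_iff, Fin.lt_def, Fin.le_def, hj] at *
        omega
      rw [hb k j this, mul_zero]
  · simp

/-- The character `η_ψ` of `U` attached to an additive character `ψ` of `K`:
`η_ψ (x) = ψ (x_{1,2} + x_{2,3} + ⋯ + x_{n-1,n})`. -/
def whittakerCharacter (n : ℕ) {K F : Type*} [Field K] [Field F] (ψ : AddChar K F) :
    unipotentSubgroup n K →* F where
  toFun u := ψ (superdiagonalSum (u : GL (Fin n) K))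
  map_one' := by
    have h := superdiagonalSum_mul (1 : unipotentSubgroup n K) 1
    rw [mul_one, left_eq_add] at h
    rw [h, AddChar.map_zero_eq_one]
  map_mul' a b := by rw [superdiagonalSum_mul, AddChar.map_add_eq_mul]

/-- A multiplicative character, as a one-dimensional representation on `F`. -/
def characterRepresentation {H F : Type*} [Group H] [Field F] (η : H →* F) :
    Representation F H F :=
  ((Algebra.lmul F F : F →* Module.End F F)).comp η

/-- The Gelfand–Graev representation `Ind_U^G η_ψ` of `G = GL_n(K)`: the space of functions
`f : G → F` with `f (u g) = η_ψ (u) f (g)` for `u ∈ U`, on which `G` acts by right translation. -/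
abbrev gelfandGraev (n : ℕ) {K F : Type*} [Field K] [Field F] (ψ : AddChar K F) :=
  Representation.coind (unipotentSubgroup n K).subtype
    (characterRepresentation (whittakerCharacter n ψ))

/-- A Whittaker model of a representation `π` of `GL_n(K)`, with respect to `ψ`: a
subrepresentation of `Ind_U^G η_ψ` isomorphic to `π`. -/
def IsWhittakerModel {n : ℕ} {K F V : Type*} [Field K] [Field F] [AddCommGroup V] [Module F V]
    (π : Representation F (GL (Fin n) K) V) (ψ : AddChar K F)
    (W : Subrepresentation (gelfandGraev n ψ)) : Prop :=
  Nonempty (π.Equiv W.toRepresentation)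

end

/-! By Frobenius reciprocity, a homomorphism from π to Ind η_ψ is a functional l on V with l(ux) =
η_ψ(u) l(x). It suffices to find one vector v such that l(v) = 0 forces l = 0
(`exists_whittaker_vector`): then all homomorphisms are multiples of a single f₀, and every
Whittaker model is the image of f₀. Let p = char K and q = |K|.

If char F = p, then ψ = 1 and l is U-invariant. The p-group U fixes a nonzero vector, which may be
taken to be a torus eigenvector. Applying to it a Hecke operator T_w that does not kill it, with w
of maximal length, gives a vector v that is moreover an eigenvector of T_s for all simple
reflections s (`exists_weight_vector`); since q = 0 in F, T_s² is a multiple of T_s there. Rank-one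
computations show that the span of U⁻v is stable under G, hence equal to V (`span_lower_eq_top`).
Translating by the longest permutation w₀, the orbit U(w₀v) spans V, so l(w₀v) determines l.

If char F ≠ p, then ψ ≠ 1 and |U| is invertible in F. Let P be |U| times the projector onto the
η_ψ-part. Gelfand's trick applies: transposition along the antidiagonal is an anti-automorphism
preserving U and η_ψ, and by the Bruhat decomposition it leaves every PgP unchanged
(`heckeOperator_antitranspose`), so these operators commute. If PV ≠ 0, they have a common
eigenvector v in PV; then l(gv) is a multiple of l(v) for all g, and the vectors gv span V. If PV =
0, then l = 0.

In the comments below, x_ij(a) denotes `elementary`, s denotes `perm (swap i j)`, and U⁻ denotes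
`unip K Fin.revPerm`, the lower triangular unipotent matrices. -/

noncomputable section
namespace GLWhittaker
open Equiv

/-! ### Monomial and elementary matrices -/

section
variable {n : ℕ} {K : Type*} [Field K]

/-- The monomial matrix with entry `d b` at position `(σ b, b)` and zeros elsewhere. -/
def monomial (σ : Perm (Fin n)) (d : Fin n → Kˣ) : GL (Fin n) K where
  val := Matrix.of fun a b => if a = σ b then (d b : K) else 0
  inv := Matrix.of fun a b => if σ a = b then (((d a)⁻¹ : Kˣ) : K) else 0
  val_inv := by
    ext a c
    obtain ⟨a, rfl⟩ := σ.surjective a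
    rw [Matrix.mul_apply, Finset.sum_eq_single a (by simp +contextual [eq_comm]) (by simp)]
    by_cases h : σ a = c
    · subst h; simp
    · simp [h]
  inv_val := by
    ext a c
    rw [Matrix.mul_apply, Finset.sum_eq_single (σ a) (by simp +contextual [eq_comm]) (by simp)]
    by_cases h : a = c
    · subst h; simp
    · simp [h]

theorem monomial_apply (σ : Perm (Fin n)) (d : Fin n → Kˣ) (a b : Fin n) :
    (monomial σ d) a b = if a = σ b then (d b : K) else 0 := rfl

theorem monomial_mul_apply (σ : Perm (Fin n)) (d : Fin n → Kˣ) (g : GL (Fin n) K)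
    (a b : Fin n) : (monomial σ d * g) (σ a) b = d a * g a b := by
  rw [Units.val_mul, Matrix.mul_apply, Finset.sum_eq_single a] <;>
    simp +contextual [monomial_apply, eq_comm]

theorem mul_monomial_apply (σ : Perm (Fin n)) (d : Fin n → Kˣ) (g : GL (Fin n) K)
    (a b : Fin n) : (g * monomial σ d) a b = g a (σ b) * d b := by
  rw [Units.val_mul, Matrix.mul_apply, Finset.sum_eq_single (σ b)] <;>
    simp +contextual [monomial_apply]

theorem monomial_mul (σ τ : Perm (Fin n)) (d e : Fin n → Kˣ) :
    monomial σ d * monomial τ e = monomial (σ * τ) (fun b => d (τ b) * e b) := by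
  ext a b
  rw [mul_monomial_apply]
  by_cases h : a = σ (τ b) <;> simp [monomial_apply, h]

theorem monomial_one : monomial (1 : Perm (Fin n)) (1 : Fin n → Kˣ) = 1 := by
  ext a b
  by_cases h : a = b <;> simp [monomial_apply, h]

theorem monomial_conj_apply (σ : Perm (Fin n)) (d : Fin n → Kˣ) (g : GL (Fin n) K)
    (a b : Fin n) :
    (monomial σ d * g * (monomial σ d)⁻¹) (σ a) (σ b) = d a * g a b * ((d b)⁻¹ : Kˣ) := by
  have h := mul_monomial_apply σ d (monomial σ d * g * (monomial σ d)⁻¹) (σ a) b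
  rw [inv_mul_cancel_right, monomial_mul_apply] at h
  rw [h, Units.mul_inv_cancel_right]

/-- Permutation matrices, as elements of the general linear group. -/
def perm : Perm (Fin n) →* GL (Fin n) K where
  toFun σ := monomial σ 1
  map_one' := monomial_one
  map_mul' σ τ := by rw [monomial_mul]; congr 1; ext; simp

theorem perm_eq (σ : Perm (Fin n)) : (perm σ : GL (Fin n) K) = monomial σ 1 := rfl

theorem perm_conj_apply (σ : Perm (Fin n)) (g : GL (Fin n) K) (a b : Fin n) :
    (perm σ * g * (perm σ)⁻¹ : GL (Fin n) K) (σ a) (σ b) = g a b := by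
  simp [perm_eq, monomial_conj_apply]

theorem perm_swap_mul_self (i j : Fin n) :
    (perm (swap i j) * perm (swap i j) : GL (Fin n) K) = 1 := by
  rw [← map_mul, swap_mul_self, map_one]

theorem perm_swap_mul_self_assoc (i j : Fin n) (g : GL (Fin n) K) :
    perm (swap i j) * (perm (swap i j) * g) = g := by
  rw [← mul_assoc, perm_swap_mul_self, one_mul]

theorem perm_swap_inv (i j : Fin n) :
    (perm (swap i j) : GL (Fin n) K)⁻¹ = perm (swap i j) := by
  rw [← map_inv, swap_inv]

theorem perm_swap_conj_apply (i j : Fin n) (g : GL (Fin n) K) (a b : Fin n) :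
    (perm (swap i j) * g * perm (swap i j) : GL (Fin n) K) a b = g (swap i j a) (swap i j b) := by
  have h := perm_conj_apply (swap i j) g (swap i j a) (swap i j b)
  rwa [swap_apply_self, swap_apply_self, perm_swap_inv] at h

/-- The elementary matrix `1 + a E_{i j}`. -/
def elementary {i j : Fin n} (h : i ≠ j) (a : K) : GL (Fin n) K where
  val := Matrix.transvection i j a
  inv := Matrix.transvection i j (-a)
  val_inv := by rw [Matrix.transvection_mul_transvection_same _ _ h]; simp
  inv_val := by rw [Matrix.transvection_mul_transvection_same _ _ h]; simp

section elementary
variable {i j : Fin n} (h : i ≠ j)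

theorem elementary_val (a : K) : (elementary h a).val = Matrix.transvection i j a := rfl

theorem elementary_mul_elementary (a b : K) :
    elementary h a * elementary h b = elementary h (a + b) := by
  apply Units.ext
  exact Matrix.transvection_mul_transvection_same _ _ h a b

theorem elementary_zero : elementary h (0 : K) = 1 := by
  apply Units.ext
  simp [elementary_val]

theorem elementary_mul_apply (a : K) (g : GL (Fin n) K) (x y : Fin n) :
    (elementary h a * g) x y = g x y + if x = i then a * g j y else 0 := by
  rw [Units.val_mul, elementary_val]
  split_ifs with hx
  · subst hx; rw [Matrix.transvection_mul_apply_same]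
  · rw [Matrix.transvection_mul_apply_of_ne _ _ _ _ hx, add_zero]

theorem mul_elementary_apply (a : K) (g : GL (Fin n) K) (x y : Fin n) :
    (g * elementary h a) x y = g x y + if y = j then a * g x i else 0 := by
  rw [Units.val_mul, elementary_val]
  split_ifs with hx
  · subst hx; rw [Matrix.mul_transvection_apply_same]
  · rw [Matrix.mul_transvection_apply_of_ne _ _ _ _ hx, add_zero]

theorem elementary_apply (a : K) (x y : Fin n) :
    (elementary h a) x y = (if x = y then 1 else 0) + if x = i ∧ y = j then a else 0 := by
  have := elementary_mul_apply h a 1 x y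
  rw [mul_one] at this
  rw [this]
  by_cases hx : x = i <;> by_cases hy : j = y <;> simp [Matrix.one_apply, hx, hy, Ne.symm]

theorem monomial_mul_elementary (σ : Perm (Fin n)) (d : Fin n → Kˣ) (a : K) :
    monomial σ d * elementary h a =
      elementary (σ.injective.ne h) (d i * a * ((d j)⁻¹ : Kˣ)) * monomial σ d := by
  ext x y
  obtain ⟨x, rfl⟩ := σ.surjective x
  simp only [monomial_mul_apply, mul_monomial_apply, elementary_apply, σ.injective.eq_iff]
  by_cases hxy : x = y
  · subst hxy; by_cases hx : x = i <;> simp [hx, h]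
  · rw [if_neg hxy]
    by_cases hx : x = i ∧ y = j
    · simp [hx]
    · simp only [if_neg hx]; simp

theorem perm_mul_elementary (σ : Perm (Fin n)) (a : K) :
    perm σ * elementary h a = elementary (σ.injective.ne h) a * perm σ := by
  have := monomial_mul_elementary h σ 1 a
  simpa [perm_eq] using this

theorem perm_swap_mul_elementary (a : K) :
    perm (swap i j) * elementary h a = elementary h.symm a * perm (swap i j) := by
  have := perm_mul_elementary h (swap i j) a
  simpa using this

theorem perm_swap_mul_elementary' (a : K) :
    perm (swap i j) * elementary h.symm a = elementary h a * perm (swap i j) := by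
  have := perm_mul_elementary h.symm (swap i j) a
  simpa using this

/-- The diagonal factor in the Bruhat decomposition of a lower elementary matrix. -/
def rankOneTorus (i j : Fin n) (a : Kˣ) : Fin n → Kˣ :=
  fun k => if k = i then a else if k = j then -a⁻¹ else 1

/-- In rows and columns i, j this is the lower-diagonal-upper factorisation of the matrix with rows
(a, 1) and (1, 0). -/
theorem elementary_mul_perm_swap (a : Kˣ) :
    elementary h (a : K) * perm (swap i j) =
      elementary h.symm ((a⁻¹ : Kˣ) : K) * monomial 1 (rankOneTorus i j a) *
        elementary h ((a⁻¹ : Kˣ) : K) := by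
  have hT : ∀ (g : GL (Fin n) K) (x y : Fin n),
      (monomial 1 (rankOneTorus i j a) * g) x y = rankOneTorus i j a x * g x y := fun g x y => by
    simpa using monomial_mul_apply 1 (rankOneTorus i j a) g x y
  ext x y
  rw [mul_assoc, elementary_mul_apply, elementary_mul_apply, hT, hT, elementary_apply,
    elementary_apply, perm_eq, monomial_apply, monomial_apply]
  by_cases hy : y = i
  · subst hy
    by_cases hx : x = y
    · subst hx; simp [rankOneTorus, h]
    · by_cases hx' : x = j <;> simp [rankOneTorus, h, h.symm, hx, hx']
  · by_cases hy' : y = j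
    · subst hy'
      by_cases hx : x = i
      · subst hx; simp [rankOneTorus, h, h.symm]
      · by_cases hx' : x = y
        · subst hx'; simp [rankOneTorus, h, h.symm]
        · simp [rankOneTorus, hx, hx']
    · rw [swap_apply_of_ne_of_ne hy hy']
      by_cases hx : x = i
      · subst hx; simp [rankOneTorus, h, Ne.symm hy, Ne.symm hy', hy']
      · by_cases hx' : x = j
        · subst hx'; simp [rankOneTorus, h.symm, Ne.symm hy, Ne.symm hy', hy']
        · by_cases hxy : x = y
          · subst hxy; simp [rankOneTorus, hx, hx']
          · simp [hx, hx', hxy]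

theorem elementary_eq_mul_perm_swap_mul (a : Kˣ) :
    elementary h.symm (a : K) = elementary h ((a⁻¹ : Kˣ) : K) * perm (swap i j) *
      elementary h (-(a : K)) * (monomial 1 (rankOneTorus i j a⁻¹))⁻¹ := by
  rw [elementary_mul_perm_swap h a⁻¹, inv_inv, mul_assoc _ (elementary h (a : K)),
    elementary_mul_elementary, add_neg_cancel, elementary_zero, mul_one, mul_inv_cancel_right]

end elementary

theorem monomial_one_inv (d : Fin n → Kˣ) : (monomial 1 d)⁻¹ = monomial 1 d⁻¹ := by
  rw [inv_eq_iff_mul_eq_one, monomial_mul, mul_one, ← monomial_one]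
  congr 1; ext; simp

theorem monomial_one_mul_perm (σ : Perm (Fin n)) (d : Fin n → Kˣ) :
    monomial 1 d * perm σ = perm σ * monomial 1 (d ∘ σ) := by
  rw [perm_eq, monomial_mul, monomial_mul]; simp

/-! ### Unipotent subgroups attached to orderings of the indices -/

/-- The unipotent subgroup attached to the ordering of the indices given by `w`. -/
def unip (K : Type*) [Field K] (w : Perm (Fin n)) : Subgroup (GL (Fin n) K) :=
  (unipotentSubgroup n K).comap (MulAut.conj (perm w)).toMonoidHom

theorem mem_unip_iff_conj {w : Perm (Fin n)} {g : GL (Fin n) K} :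
    g ∈ unip K w ↔ perm w * g * (perm w)⁻¹ ∈ unipotentSubgroup n K := Iff.rfl

theorem mem_unipotentSubgroup {g : GL (Fin n) K} : g ∈ unipotentSubgroup n K ↔
    (∀ a b : Fin n, b < a → g a b = 0) ∧ ∀ a : Fin n, g a a = 1 := Iff.rfl

theorem mem_unip {w : Perm (Fin n)} {g : GL (Fin n) K} : g ∈ unip K w ↔
    (∀ a b : Fin n, w b < w a → g a b = 0) ∧ ∀ a : Fin n, g a a = 1 := by
  rw [mem_unip_iff_conj, mem_unipotentSubgroup]
  constructor
  · rintro ⟨h1, h2⟩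
    exact ⟨fun a b hab => by rw [← perm_conj_apply w]; exact h1 _ _ hab,
      fun a => by rw [← perm_conj_apply w]; exact h2 _⟩
  · rintro ⟨h1, h2⟩
    refine ⟨w.surjective.forall.2 fun a => w.surjective.forall.2 fun b hab => ?_,
      w.surjective.forall.2 fun a => ?_⟩
    · rw [perm_conj_apply]; exact h1 _ _ hab
    · rw [perm_conj_apply]; exact h2 _

theorem unip_one : unip K (1 : Perm (Fin n)) = unipotentSubgroup n K := by
  ext g; simp [mem_unip_iff_conj]

theorem perm_conj_mem_unip {w v : Perm (Fin n)} {g : GL (Fin n) K} :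
    (perm v * g * (perm v)⁻¹ : GL (Fin n) K) ∈ unip K w ↔ g ∈ unip K (w * v) := by
  simp only [mem_unip_iff_conj, map_mul, mul_inv_rev, mul_assoc]

theorem elementary_mem_unip {w : Perm (Fin n)} {i j : Fin n} (h : i ≠ j) (hw : w i < w j) (a : K) :
    elementary h a ∈ unip K w := by
  refine mem_unip.2 ⟨fun x y hxy => ?_, fun x => ?_⟩
  · have h1 : x ≠ y := by rintro rfl; exact lt_irrefl _ hxy
    have h2 : ¬ (x = i ∧ y = j) := by rintro ⟨rfl, rfl⟩; exact lt_asymm hxy hw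
    simp [elementary_apply, h1, h2]
  · have h2 : ¬ (x = i ∧ x = j) := by rintro ⟨rfl, rfl⟩; exact h rfl
    simp [elementary_apply, h2]

theorem monomial_one_conj_mem_unip {w : Perm (Fin n)} {g : GL (Fin n) K} (d : Fin n → Kˣ)
    (hg : g ∈ unip K w) : monomial 1 d * g * (monomial 1 d)⁻¹ ∈ unip K w := by
  have h := monomial_conj_apply 1 d g
  simp only [Perm.one_apply] at h
  obtain ⟨h1, h2⟩ := mem_unip.1 hg
  refine mem_unip.2 ⟨fun a b hab => ?_, fun a => ?_⟩
  · rw [h, h1 a b hab]; simp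
  · rw [h, h2]; simp

theorem exists_mul_monomial_one {w : Perm (Fin n)} {g : GL (Fin n) K} (d : Fin n → Kˣ)
    (hg : g ∈ unip K w) : ∃ g' ∈ unip K w, monomial 1 d * g = g' * monomial 1 d :=
  ⟨_, monomial_one_conj_mem_unip d hg, by group⟩

/-- Conjugation by an adjacent transposition preserves the matrices in a unipotent subgroup whose
entry at the corresponding simple root vanishes. -/
theorem perm_swap_conj_mem_unip {w : Perm (Fin n)} {i j : Fin n} (hij : (w i : ℕ) + 1 = w j)
    {g : GL (Fin n) K} (hg : g ∈ unip K w) (h0 : g i j = 0) :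
    (perm (swap i j) * g * perm (swap i j) : GL (Fin n) K) ∈ unip K w := by
  obtain ⟨h1, h2⟩ := mem_unip.1 hg
  have hij' : i ≠ j := by rintro rfl; omega
  refine mem_unip.2 ⟨fun a b hab => ?_, fun a => ?_⟩
  · rw [perm_swap_conj_apply]
    -- As w i and w j are consecutive, (j, i) is the only pair below the diagonal that the swap
    -- moves above it; there the entry is g i j = 0.
    by_cases hc : a = j ∧ b = i
    · obtain ⟨rfl, rfl⟩ := hc; simpa
    · apply h1
      have inj : ∀ x y, (w x : ℕ) = w y → x = y := fun x y h => w.injective (Fin.ext h)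
      rw [Fin.lt_def] at hab ⊢
      rcases eq_or_ne a i with rfl | hai
      · rcases eq_or_ne b j with rfl | hbj
        · omega
        · have hba : b ≠ a := by rintro rfl; omega
          rw [swap_apply_left, swap_apply_of_ne_of_ne hba hbj]; omega
      · rcases eq_or_ne a j with rfl | haj
        · have hbi : b ≠ i := fun h => hc ⟨rfl, h⟩
          have hba : b ≠ a := by rintro rfl; omega
          have := mt (inj b i) hbi
          rw [swap_apply_right, swap_apply_of_ne_of_ne hbi hba]; omega
        · rw [swap_apply_of_ne_of_ne hai haj]
          have h3 := mt (inj a i) hai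
          have h4 := mt (inj a j) haj
          rcases eq_or_ne b i with rfl | hbi
          · rw [swap_apply_left]; omega
          · rcases eq_or_ne b j with rfl | hbj
            · rw [swap_apply_right]; omega
            · rwa [swap_apply_of_ne_of_ne hbi hbj]
  · rw [perm_swap_conj_apply]; exact h2 _

theorem elementary_mul_mem_unip {w : Perm (Fin n)} {i j : Fin n} (h : i ≠ j) (hw : w i < w j)
    {g : GL (Fin n) K} (hg : g ∈ unip K w) :
    elementary h (-(g i j)) * g ∈ unip K w ∧ (elementary h (-(g i j)) * g) i j = 0 := by
  refine ⟨mul_mem (elementary_mem_unip h hw _) hg, ?_⟩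
  rw [elementary_mul_apply, if_pos rfl, (mem_unip.1 hg).2]; ring

theorem exists_mul_elementary {w : Perm (Fin n)} {i j : Fin n} (h : i ≠ j) (hw : w i < w j)
    {g : GL (Fin n) K} (hg : g ∈ unip K w) :
    ∃ g' ∈ unip K w, ∃ a, g' i j = 0 ∧ g = g' * elementary h a := by
  refine ⟨g * elementary h (-(g i j)), mul_mem hg (elementary_mem_unip h hw _), g i j, ?_, ?_⟩
  · rw [mul_elementary_apply, if_pos rfl, (mem_unip.1 hg).2]; ring
  · rw [mul_assoc, elementary_mul_elementary]; simp [elementary_zero]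

/-! ### Generators and the Bruhat decomposition -/

/-- `GL_n(K)` is generated by the diagonal matrices, the permutation matrices of adjacent
transpositions, and the elementary matrices attached to an ordering of the indices. -/
theorem submonoid_eq_top (w : Perm (Fin n)) (S : Submonoid (GL (Fin n) K))
    (hU : ∀ (i j : Fin n) (h : i ≠ j) (a : K), w i < w j → elementary h a ∈ S)
    (hT : ∀ d : Fin n → Kˣ, monomial 1 d ∈ S)
    (hs : ∀ i j : Fin n, (i : ℕ) + 1 = j → perm (swap i j) ∈ S) : S = ⊤ := by
  have hW : ∀ σ : Perm (Fin n), perm σ ∈ S := by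
    cases n with
    | zero => intro σ; rw [Subsingleton.elim σ 1, map_one]; exact one_mem S
    | succ m =>
      have : Submonoid.comap perm S = ⊤ := by
        rw [eq_top_iff, ← Perm.mclosure_swap_castSucc_succ, Submonoid.closure_le]
        rintro _ ⟨i, rfl⟩
        exact hs _ _ (by simp)
      exact fun σ => (this.ge trivial : σ ∈ Submonoid.comap perm S)
  have hX : ∀ (i j : Fin n) (h : i ≠ j) (a : K), elementary h a ∈ S := by
    intro i j h a
    rcases lt_or_gt_of_ne (w.injective.ne h) with hlt | hlt
    · exact hU i j h a hlt
    · have h1 := mul_mem (mul_mem (hW (swap i j)) (hU j i h.symm a hlt)) (hW (swap i j))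
      rwa [perm_swap_mul_elementary', mul_assoc, perm_swap_mul_self, mul_one] at h1
  refine eq_top_iff.2 fun g _ => ?_
  have key : ∀ g' : GL (Fin n) K, g'.val = g.val → g' ∈ S := by
    refine Matrix.diagonal_transvection_induction_of_det_ne_zero
      (fun M => ∀ g' : GL (Fin n) K, g'.val = M → g' ∈ S) g.val
      ((Matrix.isUnit_iff_isUnit_det _).1 g.isUnit).ne_zero ?_ ?_ ?_
    · intro D hD g' hg'
      rw [Matrix.det_diagonal, Finset.prod_ne_zero_iff] at hD
      convert hT fun i => Units.mk0 (D i) (hD i (Finset.mem_univ i))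
      ext a b
      rw [hg', monomial_apply, Matrix.diagonal_apply]
      by_cases hab : a = b <;> simp [hab]
    · rintro ⟨i, j, h, c⟩ g' hg'
      convert hX i j h c
      ext a b
      rw [hg']; rfl
    · intro A B hA hB ihA ihB g' hg'
      have h1 := mul_mem (ihA (Matrix.GeneralLinearGroup.mkOfDetNeZero A hA) rfl)
        (ihB (Matrix.GeneralLinearGroup.mkOfDetNeZero B hB) rfl)
      convert h1
      apply Units.ext
      rw [hg']; rfl
  exact key g rfl

/-- Bruhat decomposition. -/
theorem exists_unip_mul_monomial_mul_unip (g : GL (Fin n) K) :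
    ∃ u ∈ unipotentSubgroup n K, ∃ (σ : Perm (Fin n)) (d : Fin n → Kˣ),
      ∃ u' ∈ unipotentSubgroup n K, g = u * monomial σ d * u' := by
  rw [← unip_one]
  set B : Set (GL (Fin n) K) := {g | ∃ u ∈ unip K (1 : Perm (Fin n)), ∃ (σ : Perm (Fin n))
    (d : Fin n → Kˣ), ∃ u' ∈ unip K (1 : Perm (Fin n)), g = u * monomial σ d * u'}
  -- The left stabiliser of B is a submonoid, so it is enough to check generators; applying it to 1
  -- ∈ B gives B = G.
  let S : Submonoid (GL (Fin n) K) :=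
    { carrier := {x | ∀ g ∈ B, x * g ∈ B}
      one_mem' := fun g hg => by rwa [one_mul]
      mul_mem' := fun {x y} hx hy g hg => by rw [mul_assoc]; exact hx _ (hy _ hg) }
  have hU : ∀ x ∈ unip K (1 : Perm (Fin n)), ∀ g ∈ B, x * g ∈ B := by
    rintro x hx _ ⟨u, hu, σ, d, u', hu', rfl⟩
    exact ⟨x * u, mul_mem hx hu, σ, d, u', hu', by simp only [mul_assoc]⟩
  have hU' : ∀ x ∈ unip K (1 : Perm (Fin n)), ∀ g ∈ B, g * x ∈ B := by
    rintro x hx _ ⟨u, hu, σ, d, u', hu', rfl⟩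
    exact ⟨u, hu, σ, d, u' * x, mul_mem hu' hx, by simp only [mul_assoc]⟩
  have hm : ∀ (σ : Perm (Fin n)) (d : Fin n → Kˣ), monomial σ d ∈ B := fun σ d =>
    ⟨1, one_mem _, σ, d, 1, one_mem _, by rw [one_mul, mul_one]⟩
  -- root elements pass through a monomial matrix that keeps the root positive
  have hpass : ∀ (i j : Fin n) (h : i ≠ j) (a : K) (σ : Perm (Fin n)) (d : Fin n → Kˣ),
      σ.symm i < σ.symm j →
      ∃ x ∈ unip K (1 : Perm (Fin n)), elementary h a * monomial σ d = monomial σ d * x := by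
    intro i j h a σ d hlt
    refine ⟨elementary (σ.symm.injective.ne h)
      (((d (σ.symm i))⁻¹ : Kˣ) * a * (d (σ.symm j) : K)),
      elementary_mem_unip _ (by simpa using hlt) _, ?_⟩
    rw [monomial_mul_elementary]
    congr 1
    simp [mul_assoc]
  have hS : S = ⊤ := by
    refine submonoid_eq_top 1 S (fun i j h a hlt => hU _ (elementary_mem_unip h hlt a)) ?_ ?_
    · rintro t _ ⟨u, hu, σ, d, u', hu', rfl⟩
      obtain ⟨v, hv, e⟩ := exists_mul_monomial_one t hu
      refine ⟨v, hv, 1 * σ, fun b => t (σ b) * d b, u', hu', ?_⟩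
      rw [← monomial_mul 1 σ t d, ← mul_assoc, ← mul_assoc, e, mul_assoc v]
    · rintro i j hij _ ⟨u, hu, σ, d, u', hu', rfl⟩
      have h : i ≠ j := by rintro rfl; omega
      have hlt : i < j := by rw [Fin.lt_def]; omega
      -- Write u = v x_ij(a) with v i j = 0. Since svs ∈ U, only s x_ij(a) times the monomial matrix
      -- matters.
      obtain ⟨v, hv, a, hv0, rfl⟩ := exists_mul_elementary h hlt hu
      have h1 := perm_swap_conj_mem_unip hij hv hv0
      suffices perm (swap i j) * elementary h a * monomial σ d ∈ B by
        convert hU' _ hu' _ (hU _ h1 _ this) using 1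
        simp only [mul_assoc, perm_swap_mul_self_assoc]
      have h2 : ∀ d : Fin n → Kˣ, perm (swap i j) * monomial σ d = monomial (swap i j * σ) d := fun d => by
        rw [perm_eq, monomial_mul]; simp
      rcases lt_or_gt_of_ne (σ.symm.injective.ne h) with hσ | hσ
      · obtain ⟨x, hx, e⟩ := hpass i j h a σ d hσ
        rw [mul_assoc, e, ← mul_assoc, h2]
        exact hU' _ hx _ (hm _ _)
      · rcases eq_or_ne a 0 with rfl | ha
        · rw [elementary_zero, mul_one, h2]; exact hm _ _
        · lift a to Kˣ using ha.isUnit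
          -- The root (i, j) is now made negative by σ⁻¹, hence kept positive by (sσ)⁻¹. Write s
          -- x_ij(a) = x_ji(a) s, expand x_ji(a) by the rank-one identity, and pass its right-hand
          -- factor x_ij(-a) through the monomial matrix of sσ.
          have h3 : ((swap i j * σ).symm i) < (swap i j * σ).symm j := by
            change σ.symm (swap i j i) < σ.symm (swap i j j)
            simpa using hσ
          rw [perm_swap_mul_elementary, mul_assoc, h2, elementary_eq_mul_perm_swap_mul h a,
            mul_assoc _ _ (monomial _ _), monomial_one_inv, monomial_mul, one_mul,
            mul_assoc]
          obtain ⟨x, hx, e⟩ := hpass i j h (-(a : K)) (swap i j * σ) (fun b =>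
            (rankOneTorus i j a⁻¹)⁻¹ ((swap i j * σ) b) * d b) h3
          rw [e, ← mul_assoc]
          refine hU' _ hx _ ?_
          rw [mul_assoc, perm_eq, monomial_mul]
          exact hU _ (elementary_mem_unip h hlt _) _ (hm _ _)
  have hg : g ∈ S := hS ▸ Submonoid.mem_top g
  have h1 := hg 1 (by simpa [monomial_one] using hm 1 1)
  rwa [mul_one] at h1

end

/-- By Cayley–Hamilton (g - 1)^n = 0, and p^n > n, so g^(p^n) - 1 = (g - 1)^(p^n) = 0. -/
theorem isPGroup_unipotentSubgroup (n : ℕ) (K : Type*) [Field K] (p : ℕ) [Fact p.Prime]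
    [CharP K p] : IsPGroup p (unipotentSubgroup n K) := by
  rintro ⟨g, h1, h2⟩
  refine ⟨n, Subtype.ext (Units.ext ?_)⟩
  rcases isEmpty_or_nonempty (Fin n) with _ | _
  · exact Subsingleton.elim _ _
  have hN : (g.val - 1) ^ n = 0 := by
    have h := Matrix.aeval_self_charpoly (g.val - 1)
    rw [Matrix.charpoly_of_isUpperTriangular _ fun i j hij => by
      rw [Matrix.sub_apply, h1 i j hij, Matrix.one_apply_ne (i := i) (j := j) (ne_of_gt hij), sub_zero]] at h
    simpa [h2] using h
  change g.val ^ p ^ n = 1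
  rw [← sub_add_cancel g.val 1, add_pow_char_pow_of_commute _ _ (Commute.one_right _),
    pow_eq_zero_of_le (Nat.lt_pow_self (Fact.out : p.Prime).one_lt).le hN, one_pow, zero_add]

/-! ### Irreducibility, fixed vectors and common eigenvectors -/

section Representation

variable {F G V : Type*} [Field F] [Group G] [AddCommGroup V] [Module F V]
  (ρ : Representation F G V)

theorem eq_top_of_invariant [ρ.IsIrreducible] (M : Submodule F V)
    (hM : ∀ g, ∀ v ∈ M, ρ g v ∈ M) (hne : M ≠ ⊥) : M = ⊤ := by
  rcases eq_bot_or_eq_top (⟨M, fun g v => hM g v⟩ : Subrepresentation ρ) with h | h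
  · exact absurd (congrArg Subrepresentation.toSubmodule h) hne
  · exact congrArg Subrepresentation.toSubmodule h

theorem span_orbit_eq_top [ρ.IsIrreducible] {v : V} (hv : v ≠ 0) :
    Submodule.span F (Set.range fun g => ρ g v) = ⊤ := by
  refine eq_top_of_invariant ρ _ (fun g x hx => ?_) ?_
  · refine Submodule.span_induction (p := fun x _ =>
      ρ g x ∈ Submodule.span F (Set.range fun g => ρ g v)) ?_ (by simp) ?_ ?_ hx
    · rintro _ ⟨h, rfl⟩
      exact Submodule.subset_span ⟨g * h, by simp⟩
    · intro x y _ _ hx hy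
      rw [map_add]; exact add_mem hx hy
    · intro a x _ hx
      rw [map_smul]; exact Submodule.smul_mem _ _ hx
  · intro h
    have : v ∈ Submodule.span F (Set.range fun g => ρ g v) := Submodule.subset_span ⟨1, by simp⟩
    rw [h, Submodule.mem_bot] at this
    exact hv this

theorem nontrivial_of_isIrreducible [ρ.IsIrreducible] : Nontrivial V := by
  by_contra h
  rw [not_nontrivial_iff_subsingleton] at h
  exact bot_ne_top (α := Subrepresentation ρ)
    (Subrepresentation.toSubmodule_injective (Subsingleton.elim _ _))

theorem finiteDimensional_of_isIrreducible [Finite G] [ρ.IsIrreducible] :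
    FiniteDimensional F V := by
  have := nontrivial_of_isIrreducible ρ
  obtain ⟨v, hv⟩ := exists_ne (0 : V)
  exact ⟨Submodule.fg_def.2 ⟨_, Set.finite_range _, span_orbit_eq_top ρ hv⟩⟩

/-- The 𝔽_p-span of an orbit is a finite G-stable set of p-power cardinality, so the p-group G
cannot have 0 as its only fixed point there. -/
theorem exists_fixed_vector_of_isPGroup_of_zmodModule [Finite G] [Nontrivial V] (p : ℕ)
    [Fact p.Prime] [Module (ZMod p) V] (hG : IsPGroup p G) :
    ∃ v : V, v ≠ 0 ∧ ∀ g, ρ g v = v := by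
  obtain ⟨v, hv⟩ := exists_ne (0 : V)
  let A : Submodule (ZMod p) V := Submodule.span (ZMod p) (Set.range fun g => ρ g v)
  have hA : ∀ (g : G) (x : V), x ∈ A → ρ g x ∈ A := fun g x hx => by
    have h : A ≤ A.comap ((ρ g).toAddMonoidHom.toZModLinearMap p) := by
      refine Submodule.span_le.2 ?_
      rintro _ ⟨h, rfl⟩
      exact Submodule.subset_span ⟨g * h, by simp⟩
    exact Submodule.mem_comap.1 (h hx)
  have hfin : Module.Finite (ZMod p) A :=
    Module.Finite.span_of_finite (ZMod p) (Set.finite_range fun g => ρ g v)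
  have : Finite A := Module.finite_of_finite (ZMod p)
  let _ : MulAction G A :=
    { smul := fun g x => ⟨ρ g x, hA g x x.2⟩
      one_smul := fun x => Subtype.ext (by change ρ 1 (x : V) = x; simp)
      mul_smul := fun g h x => Subtype.ext (by
        change ρ (g * h) (x : V) = ρ g (ρ h (x : V)); simp) }
  have hvA : v ∈ A := Submodule.subset_span ⟨1, by simp⟩
  have : Nontrivial A := ⟨⟨⟨v, hvA⟩, 0, fun h => hv (congrArg Subtype.val h)⟩⟩
  have hp : p ∣ Nat.card A := by
    rw [Module.natCard_eq_pow_finrank (K := ZMod p), Nat.card_zmod]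
    exact dvd_pow_self _ Module.finrank_pos.ne'
  obtain ⟨b, hb, hb0⟩ := hG.exists_fixed_point_of_prime_dvd_card_of_fixed_point A hp
    (a := 0) fun g => Subtype.ext (map_zero (ρ g))
  exact ⟨b, fun h => hb0 (Subtype.ext h.symm), fun g => congrArg Subtype.val (hb g)⟩

/-- A `p`-group acting linearly on a nonzero space in characteristic `p` fixes a nonzero vector. -/
theorem exists_fixed_vector_of_isPGroup [Finite G] [Nontrivial V] (p : ℕ) [Fact p.Prime]
    [CharP F p] (hG : IsPGroup p G) : ∃ v : V, v ≠ 0 ∧ ∀ g, ρ g v = v :=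
  have : Module (ZMod p) V := AddCommGroup.zmodModule fun x => by
    rw [← Nat.cast_smul_eq_nsmul F, CharP.cast_eq_zero, zero_smul]
  exists_fixed_vector_of_isPGroup_of_zmodModule ρ p hG

/-- In a minimal nonzero stable subspace M of W, each eigenspace of f i is stable by commutativity,
hence is all of M. -/
theorem exists_common_eigenvector [IsAlgClosed F] [FiniteDimensional F V] {ι : Type*}
    (f : ι → Module.End F V) (hf : ∀ i j v, f i (f j v) = f j (f i v)) (W : Submodule F V)
    (hW : W ≠ ⊥) (hfW : ∀ i, ∀ v ∈ W, f i v ∈ W) :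
    ∃ v ∈ W, v ≠ 0 ∧ ∀ i, ∃ c : F, f i v = c • v := by
  obtain ⟨M, ⟨hMW, hM, hfM⟩, hmin⟩ := wellFounded_lt.has_min
    {M : Submodule F V | M ≤ W ∧ M ≠ ⊥ ∧ ∀ i, ∀ v ∈ M, f i v ∈ M} ⟨W, le_rfl, hW, hfW⟩
  obtain ⟨v, hv, hv0⟩ := M.ne_bot_iff.1 hM
  refine ⟨v, hMW hv, hv0, fun i => ?_⟩
  have : Nontrivial M := ⟨⟨⟨v, hv⟩, 0, fun h => hv0 (congrArg Subtype.val h)⟩⟩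
  obtain ⟨c, hc⟩ := Module.End.exists_eigenvalue ((f i).restrict (hfM i))
  obtain ⟨x, hx⟩ := hc.exists_hasEigenvector
  have hx1 : f i x = c • (x : V) := congrArg Subtype.val hx.apply_eq_smul
  let M' : Submodule F V := M ⊓ LinearMap.ker (f i - c • 1)
  have hmem : ∀ y, y ∈ M' ↔ y ∈ M ∧ f i y = c • y := fun y => by
    simp [M', sub_eq_zero]
  have hM' : M' = M := by
    by_contra hne
    refine hmin M' ⟨inf_le_left.trans hMW, ?_, fun j y hy => ?_⟩ (lt_of_le_of_ne inf_le_left hne)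
    · exact (Submodule.ne_bot_iff _).2 ⟨x, (hmem _).2 ⟨x.2, hx1⟩, fun h => hx.2 (Subtype.ext h)⟩
    · obtain ⟨h1, h2⟩ := (hmem y).1 hy
      exact (hmem _).2 ⟨hfM j y h1, by rw [hf, h2, map_smul]⟩
  exact ⟨c, ((hmem v).1 (hM' ▸ hv)).2⟩

end Representation

/-! ### Defining characteristic: weight vectors and U-invariant functionals -/

section DefiningCharacteristic

variable {n : ℕ} {F K V : Type*} [Field F] [Field K] [AddCommGroup V] [Module F V]
  (ρ : Representation F (GL (Fin n) K) V)

/-- The vector `v` is fixed by the upper triangular unipotent matrices. -/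
def IsUnipFixed (v : V) : Prop := ∀ u ∈ unip K (1 : Perm (Fin n)), ρ u v = v

/-- The vector `v` is an eigenvector of all diagonal matrices. -/
def IsTorusEigen (v : V) : Prop := ∀ d : Fin n → Kˣ, ∃ c : F, ρ (monomial 1 d) v = c • v

/-- The action on the vectors fixed by the unipotent subgroup of the Hecke operator of a simple
reflection. -/
def simpleSum [Fintype K] {i j : Fin n} (h : i ≠ j) (v : V) : V :=
  ∑ a : K, ρ (elementary h a) (ρ (perm (swap i j)) v)

/-- The unipotent elements made lower triangular by conjugation with `w⁻¹`. -/
def invertedUnip [Finite K] (w : Perm (Fin n)) : Finset (GL (Fin n) K) :=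
  (Set.toFinite ((unip K 1 ⊓ unip K (Fin.revPerm * w⁻¹) : Subgroup (GL (Fin n) K)) :
    Set (GL (Fin n) K))).toFinset

/-- The action on the vectors fixed by the unipotent subgroup of the Hecke operator of `w`. -/
def heckeSum [Finite K] (w : Perm (Fin n)) (v : V) : V :=
  ∑ u ∈ invertedUnip w, ρ u (ρ (perm w) v)

theorem mem_invertedUnip [Finite K] {w : Perm (Fin n)} {g : GL (Fin n) K} :
    g ∈ invertedUnip w ↔ g ∈ unip K 1 ∧ g ∈ unip K (Fin.revPerm * w⁻¹) := by
  simp [invertedUnip]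

variable {ρ}

section rankOne
variable {i j : Fin n} (h : i ≠ j)

theorem IsUnipFixed.elementary {v : V} (hv : IsUnipFixed ρ v) (hij : i < j) (a : K) :
    ρ (elementary h a) v = v := hv _ (elementary_mem_unip h hij a)

theorem exists_elementary_swap_eq_smul {v : V} (hv : IsUnipFixed ρ v) (hT : IsTorusEigen ρ v)
    (hij : i < j) (a : Kˣ) : ∃ c : F, ρ (elementary h (a : K)) (ρ (perm (swap i j)) v) =
      c • ρ (elementary h.symm ((a⁻¹ : Kˣ) : K)) v := by
  obtain ⟨c, hc⟩ := hT (rankOneTorus i j a)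
  refine ⟨c, ?_⟩
  rw [← Module.End.mul_apply, ← map_mul, elementary_mul_perm_swap, map_mul, map_mul,
    Module.End.mul_apply, Module.End.mul_apply, hv.elementary h hij, hc, map_smul]

theorem exists_elementary_eq_smul_swap {v : V} (hv : IsUnipFixed ρ v) (hT : IsTorusEigen ρ v)
    (hij : i < j) (a : Kˣ) : ∃ c : F, ρ (elementary h.symm (a : K)) v =
      c • ρ (elementary h ((a⁻¹ : Kˣ) : K)) (ρ (perm (swap i j)) v) := by
  obtain ⟨c, hc⟩ := hT (rankOneTorus i j a⁻¹)⁻¹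
  refine ⟨c, ?_⟩
  rw [elementary_eq_mul_perm_swap_mul, map_mul, map_mul, map_mul, Module.End.mul_apply,
    Module.End.mul_apply, Module.End.mul_apply, monomial_one_inv, hc, map_smul,
    hv.elementary h hij, map_smul, map_smul]

/-- Left multiplication by u permutes the summands: u x_ij(a) = x_ij(a + u_ij) x with x_ij-entry of
x zero, so sxs lies in U and fixes v. -/
theorem simpleSum_isUnipFixed [Fintype K] {v : V} (hv : IsUnipFixed ρ v)
    (hij : (i : ℕ) + 1 = j) : IsUnipFixed ρ (simpleSum ρ h v) := by
  intro u hu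
  have hlt : i < j := by rw [Fin.lt_def]; omega
  rw [simpleSum, map_sum]
  refine Fintype.sum_equiv (Equiv.addRight (u i j)) _ _ fun a => ?_
  have hw := mul_mem hu (elementary_mem_unip h (w := 1) hlt a)
  have hentry : (u * elementary h a) i j = a + u i j := by
    rw [mul_elementary_apply, if_pos rfl, (mem_unip.1 hu).2]; ring
  obtain ⟨h1, h2⟩ := elementary_mul_mem_unip h (w := 1) hlt hw
  have h3 := perm_swap_conj_mem_unip (w := 1) hij h1 h2
  set x := elementary h (-((u * elementary h a) i j)) * (u * elementary h a) with hx
  have h4 : u * elementary h a = elementary h (a + u i j) * x := by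
    rw [hx, ← mul_assoc, elementary_mul_elementary, hentry, add_neg_cancel, elementary_zero,
      one_mul]
  have h5 : x * perm (swap i j) = perm (swap i j) * (perm (swap i j) * x * perm (swap i j)) := by
    simp only [mul_assoc, perm_swap_mul_self_assoc]
  simp only [Equiv.coe_addRight, ← Module.End.mul_apply, ← map_mul]
  rw [← mul_assoc, h4, mul_assoc, h5, ← mul_assoc, map_mul, Module.End.mul_apply, hv _ h3]

/-- In the double sum of x_ij(a) s x_ij(b) s v, the factor s x_ij(b) s equals x_ji(b). The terms
with b = 0 add up to qv = 0; for b ≠ 0 the rank-one identity turns x_ji(b) v into a multiple of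
x_ij(b⁻¹) s v, and summing over a gives a multiple of T_s v. -/
theorem exists_simpleSum_simpleSum_eq_smul [Fintype K] (hq : (Fintype.card K : F) = 0) {v : V}
    (hv : IsUnipFixed ρ v) (hT : IsTorusEigen ρ v) (hij : i < j) :
    ∃ c : F, simpleSum ρ h (simpleSum ρ h v) = c • simpleSum ρ h v := by
  classical
  have key : ∀ b : K, ∃ c : F, ∑ a : K, ρ (elementary h a) (ρ (perm (swap i j))
      (ρ (elementary h b) (ρ (perm (swap i j)) v))) = c • simpleSum ρ h v := by
    intro b
    have h1 : ρ (perm (swap i j)) (ρ (elementary h b) (ρ (perm (swap i j)) v)) =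
        ρ (elementary h.symm b) v := by
      simp only [← Module.End.mul_apply, ← map_mul]
      rw [← mul_assoc, perm_swap_mul_elementary, mul_assoc, perm_swap_mul_self, mul_one]
    rw [h1]
    rcases eq_or_ne b 0 with rfl | hb
    · refine ⟨0, ?_⟩
      simp only [elementary_zero, map_one, Module.End.one_apply, hv.elementary h hij, zero_smul,
        Finset.sum_const, Finset.card_univ]
      rw [← Nat.cast_smul_eq_nsmul F, hq, zero_smul]
    · lift b to Kˣ using hb.isUnit
      obtain ⟨c, hc⟩ := exists_elementary_eq_smul_swap h hv hT hij b
      refine ⟨c, ?_⟩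
      rw [hc, simpleSum, Finset.smul_sum]
      refine Fintype.sum_equiv (Equiv.addRight ((b⁻¹ : Kˣ) : K)) _ _ fun a => ?_
      rw [map_smul, Equiv.coe_addRight, ← elementary_mul_elementary, map_mul,
        Module.End.mul_apply]
  choose c hc using key
  refine ⟨∑ b, c b, ?_⟩
  rw [Finset.sum_smul, ← Finset.sum_congr rfl fun b _ => hc b, Finset.sum_comm]
  simp only [simpleSum, map_sum]

/-- If c = 0, solve T_s v = 0 for the term a = 0, which is sv; the other terms are multiples of
vectors x_ji(a⁻¹) v. If c ≠ 0, apply s to T_s v = cv and use s x_ij(a) s = x_ji(a). -/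
theorem swap_mem_span_of_simpleSum_eq_smul [Fintype K] {v : V} (hv : IsUnipFixed ρ v)
    (hT : IsTorusEigen ρ v) (hij : i < j) {c : F} (hc : simpleSum ρ h v = c • v) :
    ρ (perm (swap i j)) v ∈ Submodule.span F (Set.range fun a : K => ρ (elementary h.symm a) v) := by
  classical
  set M := Submodule.span F (Set.range fun a : K => ρ (elementary h.symm a) v)
  have hM : ∀ a : K, ρ (elementary h.symm a) v ∈ M := fun a => Submodule.subset_span ⟨a, rfl⟩
  rcases eq_or_ne c 0 with rfl | hc0
  · rw [zero_smul, simpleSum, Fintype.sum_eq_add_sum_compl 0, elementary_zero, map_one,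
      Module.End.one_apply, add_eq_zero_iff_eq_neg] at hc
    rw [hc]
    refine neg_mem (sum_mem fun a ha => ?_)
    have ha0 : a ≠ 0 := by simpa using ha
    lift a to Kˣ using ha0.isUnit
    obtain ⟨e, he⟩ := exists_elementary_swap_eq_smul h hv hT hij a
    rw [he]
    exact Submodule.smul_mem _ _ (hM _)
  · have h1 := congrArg (ρ (perm (swap i j))) hc
    rw [map_smul] at h1
    rw [← inv_smul_smul₀ hc0 (ρ (perm (swap i j)) v), ← h1, simpleSum, map_sum]
    refine Submodule.smul_mem _ _ (sum_mem fun a _ => ?_)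
    convert hM a using 1
    simp only [← Module.End.mul_apply, ← map_mul]
    rw [← mul_assoc, perm_swap_mul_elementary, mul_assoc, perm_swap_mul_self, mul_one]

/-- This is T_s T_w = T_{sw} when the length increases: (a, u) ↦ x_ij(a) sus is a bijection onto
`invertedUnip (swap i j * w)`, with a recovered as the (i, j) entry. -/
theorem simpleSum_heckeSum [Fintype K] {w : Perm (Fin n)} (hij : (i : ℕ) + 1 = j)
    (hw : w⁻¹ i < w⁻¹ j) (v : V) :
    simpleSum ρ h (heckeSum ρ w v) = heckeSum ρ (swap i j * w) v := by
  have hlt : i < j := by rw [Fin.lt_def]; omega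
  have hs : Fin.revPerm * (swap i j * w)⁻¹ = Fin.revPerm * w⁻¹ * swap i j := by
    rw [mul_inv_rev, swap_inv, mul_assoc]
  have hconj : ∀ g : GL (Fin n) K, perm (swap i j) * g * perm (swap i j) ∈
      unip K (Fin.revPerm * w⁻¹ * swap i j) ↔ g ∈ unip K (Fin.revPerm * w⁻¹) := by
    intro g
    rw [← perm_conj_mem_unip, perm_swap_inv]
    simp only [mul_assoc, perm_swap_mul_self_assoc, perm_swap_mul_self, mul_one]
  have hX : ∀ a : K, elementary h a ∈ unip K (Fin.revPerm * w⁻¹ * swap i j) := fun a =>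
    elementary_mem_unip h (by simpa using hw) a
  simp only [simpleSum, heckeSum, map_sum]
  rw [← Finset.sum_product']
  refine Finset.sum_bij' (fun x _ => elementary h x.1 * (perm (swap i j) * x.2 * perm (swap i j)))
    (fun u _ => (u i j, perm (swap i j) * (elementary h (-(u i j)) * u) * perm (swap i j)))
    ?_ ?_ ?_ ?_ ?_
  · rintro ⟨a, u⟩ hu
    obtain ⟨h1, h2⟩ := mem_invertedUnip.1 (Finset.mem_product.1 hu).2
    have h0 : u i j = 0 := (mem_unip.1 h2).1 i j (by simpa using hw)
    refine mem_invertedUnip.2 ⟨mul_mem (elementary_mem_unip h hlt a)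
      (perm_swap_conj_mem_unip (w := 1) hij h1 h0), ?_⟩
    rw [hs]
    exact mul_mem (hX a) ((hconj u).2 h2)
  · intro u hu
    obtain ⟨h1, h2⟩ := mem_invertedUnip.1 hu
    obtain ⟨h3, h4⟩ := elementary_mul_mem_unip h (w := 1) hlt h1
    refine Finset.mem_product.2 ⟨Finset.mem_univ _, mem_invertedUnip.2
      ⟨perm_swap_conj_mem_unip (w := 1) hij h3 h4, ?_⟩⟩
    rw [← hconj]
    simp only [mul_assoc, perm_swap_mul_self_assoc, perm_swap_mul_self, mul_one]
    rw [hs] at h2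
    exact mul_mem (hX _) h2
  · rintro ⟨a, u⟩ hu
    obtain ⟨h1, h2⟩ := mem_invertedUnip.1 (Finset.mem_product.1 hu).2
    have h0 : u i j = 0 := (mem_unip.1 h2).1 i j (by simpa using hw)
    have h3 := mem_unip.1 (perm_swap_conj_mem_unip (w := 1) hij h1 h0)
    have h4 : (perm (swap i j) * u * perm (swap i j) : GL (Fin n) K) i j = 0 := by
      rw [perm_swap_conj_apply, swap_apply_left, swap_apply_right]
      exact (mem_unip.1 h1).1 j i hlt
    have h5 : (elementary h a * (perm (swap i j) * u * perm (swap i j)) : GL (Fin n) K) i j = a := by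
      rw [elementary_mul_apply, if_pos rfl, h4, h3.2]; ring
    refine Prod.ext h5 ?_
    dsimp only
    rw [h5, ← mul_assoc (elementary h (-a)), elementary_mul_elementary, neg_add_cancel,
      elementary_zero, one_mul]
    simp only [mul_assoc, perm_swap_mul_self_assoc, perm_swap_mul_self, mul_one]
  · intro u hu
    simp only [mul_assoc, perm_swap_mul_self_assoc, perm_swap_mul_self, mul_one]
    rw [← mul_assoc, elementary_mul_elementary, add_neg_cancel, elementary_zero, one_mul]
  · rintro ⟨a, u⟩ hu
    simp only [map_mul perm (swap i j) w, ← Module.End.mul_apply, ← map_mul ρ, mul_assoc,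
      perm_swap_mul_self_assoc]

end rankOne

/-- This cardinality plays the role of the length of w. Conjugation by s embeds one set in the other
and misses x_ij(1), since the image has zero (i, j) entries. -/
theorem card_invertedUnip_lt [Finite K] {i j : Fin n} {w : Perm (Fin n)}
    (hij : (i : ℕ) + 1 = j) (hw : w⁻¹ i < w⁻¹ j) :
    (invertedUnip w : Finset (GL (Fin n) K)).card <
      (invertedUnip (swap i j * w) : Finset (GL (Fin n) K)).card := by
  classical
  have hlt : i < j := by rw [Fin.lt_def]; omega
  have hs : Fin.revPerm * (swap i j * w)⁻¹ = Fin.revPerm * w⁻¹ * swap i j := by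
    rw [mul_inv_rev, swap_inv, mul_assoc]
  let f : GL (Fin n) K → GL (Fin n) K := fun u => perm (swap i j) * u * perm (swap i j)
  have hf : Function.Injective f := fun a b h => mul_left_cancel (mul_right_cancel h)
  rw [← Finset.card_image_of_injective _ hf]
  refine Finset.card_lt_card ((Finset.ssubset_iff_of_subset ?_).2
    ⟨elementary hlt.ne 1, ?_, ?_⟩)
  · intro g hg
    obtain ⟨u, hu, rfl⟩ := Finset.mem_image.1 hg
    obtain ⟨h1, h2⟩ := mem_invertedUnip.1 hu
    have h0 : u i j = 0 := (mem_unip.1 h2).1 i j (by simpa using hw)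
    refine mem_invertedUnip.2 ⟨perm_swap_conj_mem_unip (w := 1) hij h1 h0, ?_⟩
    rw [hs, ← perm_conj_mem_unip, perm_swap_inv]
    simpa only [f, mul_assoc, perm_swap_mul_self_assoc, perm_swap_mul_self, mul_one] using h2
  · refine mem_invertedUnip.2 ⟨elementary_mem_unip _ hlt _, ?_⟩
    rw [hs]
    exact elementary_mem_unip _ (by simpa using hw) _
  · intro hg
    obtain ⟨u, hu, h⟩ := Finset.mem_image.1 hg
    have h1 := (mem_unip.1 (mem_invertedUnip.1 hu).1).1 j i hlt
    have h2 : (f u) i j = 0 := by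
      rw [perm_swap_conj_apply, swap_apply_left, swap_apply_right, h1]
    rw [h, elementary_apply] at h2
    simp [hlt.ne] at h2

theorem heckeSum_one [Finite K] (v : V) : heckeSum ρ 1 v = v := by
  have h : invertedUnip (1 : Perm (Fin n)) = ({1} : Finset (GL (Fin n) K)) := by
    ext g
    rw [mem_invertedUnip, Finset.mem_singleton]
    refine ⟨fun ⟨h1, h2⟩ => ?_, fun h => h ▸ ⟨one_mem _, one_mem _⟩⟩
    rw [mem_unip] at h1 h2
    ext a b
    rcases lt_trichotomy a b with hab | rfl | hab
    · rw [h2.1 a b (by simpa using hab)]; simp [hab.ne]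
    · rw [h1.2]; simp
    · rw [h1.1 a b hab]; simp [hab.ne']
  rw [heckeSum, h]; simp

theorem exists_descent {w : Perm (Fin n)} (hw : w ≠ 1) :
    ∃ i j : Fin n, (i : ℕ) + 1 = j ∧ w j < w i := by
  by_contra! h
  apply hw
  cases n with
  | zero => exact Subsingleton.elim _ _
  | succ m =>
    have hmono : StrictMono w := Fin.strictMono_iff_lt_succ.2 fun i =>
      lt_of_le_of_ne (h _ _ (by simp)) (w.injective.ne (Fin.castSucc_lt_succ (i := i)).ne)
    ext a
    exact congrArg Fin.val (DFunLike.congr_fun (Subsingleton.elim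
      (hmono.orderIsoOfSurjective w w.surjective) (OrderIso.refl _)) a)

theorem exists_heckeSum_eq_simpleSum [Fintype K] {i j : Fin n} (h : i ≠ j) {w : Perm (Fin n)}
    (hij : (i : ℕ) + 1 = j) (hw : w⁻¹ j < w⁻¹ i) :
    (invertedUnip (swap i j * w) : Finset (GL (Fin n) K)).card <
      (invertedUnip w : Finset (GL (Fin n) K)).card ∧
    ∀ v, heckeSum ρ w v = simpleSum ρ h (heckeSum ρ (swap i j * w) v) := by
  have h1 : (swap i j * w)⁻¹ i < (swap i j * w)⁻¹ j := by simpa using hw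
  refine ⟨?_, fun v => ?_⟩
  · have := card_invertedUnip_lt (K := K) hij h1
    rwa [swap_mul_self_mul] at this
  · rw [simpleSum_heckeSum h hij h1, swap_mul_self_mul]

theorem heckeSum_isUnipFixed [Fintype K] {v : V} (hv : IsUnipFixed ρ v) (w : Perm (Fin n)) :
    IsUnipFixed ρ (heckeSum ρ w v) := by
  induction hc : (invertedUnip w : Finset (GL (Fin n) K)).card using Nat.strong_induction_on
    generalizing w with
  | _ c ih =>
    rcases eq_or_ne w 1 with rfl | hw
    · rwa [heckeSum_one]
    · obtain ⟨i, j, hij, hlt⟩ := exists_descent (inv_ne_one.2 hw)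
      have h : i ≠ j := by rintro rfl; omega
      obtain ⟨h1, h2⟩ := exists_heckeSum_eq_simpleSum (ρ := ρ) h hij hlt
      rw [h2]
      exact simpleSum_isUnipFixed h (ih _ (hc ▸ h1) _ rfl) hij

/-- Conjugation by the torus permutes `invertedUnip w`, and w carries the torus to itself. -/
theorem heckeSum_isTorusEigen [Finite K] {v : V} (hv : IsTorusEigen ρ v) (w : Perm (Fin n)) :
    IsTorusEigen ρ (heckeSum ρ w v) := by
  intro d
  obtain ⟨c, hc⟩ := hv (d ∘ w)
  have hd : ∀ (e : Fin n → Kˣ) (u : GL (Fin n) K), u ∈ invertedUnip w →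
      monomial 1 e * u * (monomial 1 e)⁻¹ ∈ invertedUnip w := fun e u hu =>
    mem_invertedUnip.2 ⟨monomial_one_conj_mem_unip e (mem_invertedUnip.1 hu).1,
      monomial_one_conj_mem_unip e (mem_invertedUnip.1 hu).2⟩
  refine ⟨c, ?_⟩
  rw [heckeSum, map_sum, Finset.smul_sum]
  refine Finset.sum_bij' (fun u _ => monomial 1 d * u * (monomial 1 d)⁻¹)
    (fun u _ => (monomial 1 d)⁻¹ * u * monomial 1 d) (hd d) (fun u hu => ?_)
    (fun u _ => by group) (fun u _ => by group) (fun u _ => ?_)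
  · have := hd d⁻¹ u hu
    rwa [← monomial_one_inv, inv_inv] at this
  · rw [← map_smul, ← map_smul, ← hc]
    simp only [← Module.End.mul_apply, ← map_mul ρ, mul_assoc]
    rw [← monomial_one_mul_perm, inv_mul_cancel_left]

theorem exists_weight_vector [IsAlgClosed F] [Fintype K] [ρ.IsIrreducible] (p : ℕ)
    [Fact p.Prime] [CharP F p] [CharP K p] :
    ∃ v : V, v ≠ 0 ∧ IsUnipFixed ρ v ∧ IsTorusEigen ρ v ∧
      ∀ (i j : Fin n) (h : i ≠ j), (i : ℕ) + 1 = j → ∃ c : F, simpleSum ρ h v = c • v := by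
  classical
  have := nontrivial_of_isIrreducible ρ
  have := finiteDimensional_of_isIrreducible ρ
  obtain ⟨v₁, hv₁, hU₁⟩ := exists_fixed_vector_of_isPGroup
    (ρ.comp (unipotentSubgroup n K).subtype) p (isPGroup_unipotentSubgroup n K p)
  let W : Submodule F V := ⨅ u : unip K (1 : Perm (Fin n)), LinearMap.ker (ρ u - 1)
  have hW : ∀ x, x ∈ W ↔ IsUnipFixed ρ x := fun x => by
    simp [W, IsUnipFixed, sub_eq_zero]
  obtain ⟨v, hvW, hv, hT⟩ := exists_common_eigenvector
    (fun d : Fin n → Kˣ => ρ (monomial 1 d)) (fun d e x => by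
      simp only [← Module.End.mul_apply, ← map_mul, monomial_mul, mul_one, Perm.one_apply,
        mul_comm])
    W ((Submodule.ne_bot_iff _).2 ⟨v₁, (hW _).2 fun u hu => hU₁ ⟨u, by rwa [← unip_one]⟩, hv₁⟩)
    (fun d x hx => (hW _).2 fun u hu => by
      have h1 := monomial_one_conj_mem_unip d⁻¹ hu
      rw [← Module.End.mul_apply, ← map_mul, show u * monomial 1 d = monomial 1 d *
        (monomial 1 d⁻¹ * u * (monomial 1 d⁻¹)⁻¹) by rw [← monomial_one_inv]; group,
        map_mul, Module.End.mul_apply, (hW x).1 hx _ h1])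
  have hvU := (hW v).1 hvW
  -- Take w of maximal length with T_w v ≠ 0. If sw is longer, T_s T_w v = T_{sw} v vanishes by
  -- maximality; if shorter, T_w v = T_s T_{sw} v, and T_s² is a multiple of T_s.
  obtain ⟨w, hw, hmax⟩ := Finset.exists_max_image
    (Finset.univ.filter fun w : Perm (Fin n) => heckeSum ρ w v ≠ 0)
    (fun w => (invertedUnip w : Finset (GL (Fin n) K)).card) ⟨1, by simpa [heckeSum_one] using hv⟩
  refine ⟨heckeSum ρ w v, by simpa using hw, heckeSum_isUnipFixed hvU w,
    heckeSum_isTorusEigen hT w, fun i j h hij => ?_⟩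
  rcases lt_or_gt_of_ne (w⁻¹.injective.ne h) with hlt | hlt
  · refine ⟨0, ?_⟩
    rw [simpleSum_heckeSum h hij hlt, zero_smul]
    by_contra hne
    exact (card_invertedUnip_lt (K := K) hij hlt).not_ge (hmax _ (by simpa using hne))
  · obtain ⟨-, h2⟩ := exists_heckeSum_eq_simpleSum (ρ := ρ) h hij hlt
    rw [h2]
    refine exists_simpleSum_simpleSum_eq_smul h ?_ (heckeSum_isUnipFixed hvU _)
      (heckeSum_isTorusEigen hT _) (by rw [Fin.lt_def]; omega)
    rw [CharP.cast_eq_zero_iff F p, ← CharP.cast_eq_zero_iff K p, Nat.cast_card_eq_zero]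

/-- A weight vector generates the representation under the lower triangular unipotent matrices. -/
theorem span_lower_eq_top [Fintype K] [ρ.IsIrreducible] {v : V} (hv0 : v ≠ 0)
    (hv : IsUnipFixed ρ v) (hT : IsTorusEigen ρ v)
    (hs : ∀ (i j : Fin n) (h : i ≠ j), (i : ℕ) + 1 = j → ∃ c : F, simpleSum ρ h v = c • v) :
    Submodule.span F (Set.range fun u : unip K (Fin.revPerm : Perm (Fin n)) => ρ u v) = ⊤ := by
  set M := Submodule.span F (Set.range fun u : unip K (Fin.revPerm : Perm (Fin n)) => ρ u v)
  have hM : ∀ u ∈ unip K (Fin.revPerm : Perm (Fin n)), ρ u v ∈ M := fun u hu =>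
    Submodule.subset_span ⟨⟨u, hu⟩, rfl⟩
  have hstab : ∀ g : GL (Fin n) K, (∀ u ∈ unip K (Fin.revPerm : Perm (Fin n)),
      ρ g (ρ u v) ∈ M) → ∀ x ∈ M, ρ g x ∈ M := fun g hg => by
    suffices M ≤ M.comap (ρ g) from this
    refine Submodule.span_le.2 ?_
    rintro _ ⟨u, rfl⟩
    exact hg u u.2
  have hMU : ∀ g ∈ unip K (Fin.revPerm : Perm (Fin n)), ∀ x ∈ M, ρ g x ∈ M := fun g hg =>
    hstab g fun u hu => by
      rw [← Module.End.mul_apply, ← map_mul]; exact hM _ (mul_mem hg hu)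
  let S : Submonoid (GL (Fin n) K) :=
    { carrier := {g | ∀ x ∈ M, ρ g x ∈ M}
      one_mem' := fun x hx => by simpa using hx
      mul_mem' := fun {a b} ha hb x hx => by
        rw [map_mul, Module.End.mul_apply]; exact ha _ (hb _ hx) }
  have hS : S = ⊤ := by
    refine submonoid_eq_top Fin.revPerm S
      (fun i j h a hlt => hMU _ (elementary_mem_unip h hlt a)) (fun d => hstab _ fun u hu => ?_)
      fun i j hij => hstab _ fun u hu => ?_
    · obtain ⟨u', hu', e⟩ := exists_mul_monomial_one d hu
      obtain ⟨c, hc⟩ := hT d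
      rw [← Module.End.mul_apply, ← map_mul, e, map_mul, Module.End.mul_apply, hc, map_smul]
      exact M.smul_mem _ (hM _ hu')
    · have hlt : i < j := by rw [Fin.lt_def]; omega
      have hrev : ((Fin.revPerm j : Fin n) : ℕ) + 1 = Fin.revPerm i := by
        simp only [Fin.revPerm_apply, Fin.val_rev]; omega
      -- Write u = u' x_ji(a), where (j, i) is simple for the reversed order, so su's stays in U⁻.
      -- It remains to treat x_ij(a) s v: rank-one identity for a ≠ 0, the T_s-eigenvalue equation
      -- for a = 0.
      obtain ⟨u', hu', a, h0, rfl⟩ := exists_mul_elementary hlt.ne' (by simpa using hlt) hu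
      have h1 := perm_swap_conj_mem_unip hrev hu' h0
      rw [swap_comm] at h1
      have h2 : ρ (perm (swap i j)) (ρ (u' * elementary hlt.ne' a) v) =
          ρ (perm (swap i j) * u' * perm (swap i j))
            (ρ (elementary hlt.ne a) (ρ (perm (swap i j)) v)) := by
        simp only [← Module.End.mul_apply, ← map_mul ρ, mul_assoc]
        rw [← perm_swap_mul_elementary', perm_swap_mul_self_assoc]
      rw [h2]
      refine hMU _ h1 _ ?_
      rcases eq_or_ne a 0 with rfl | ha
      · obtain ⟨c, hc⟩ := hs i j hlt.ne hij
        rw [elementary_zero, map_one, Module.End.one_apply]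
        refine Submodule.span_le.2 ?_ (swap_mem_span_of_simpleSum_eq_smul hlt.ne hv hT hlt hc)
        rintro _ ⟨b, rfl⟩
        exact hM _ (elementary_mem_unip _ (by simpa using hlt) _)
      · lift a to Kˣ using ha.isUnit
        obtain ⟨c, hc⟩ := exists_elementary_swap_eq_smul hlt.ne hv hT hlt a
        rw [hc]
        exact M.smul_mem _ (hM _ (elementary_mem_unip _ (by simpa using hlt) _))
  refine eq_top_of_invariant ρ M (fun g => (hS.ge trivial : g ∈ S))
    ((Submodule.ne_bot_iff _).2 ⟨v, by simpa using hM 1 (one_mem _), hv0⟩)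

theorem exists_vector_of_charP [IsAlgClosed F] [Finite K] [ρ.IsIrreducible] (p : ℕ)
    [Fact p.Prime] [CharP F p] [CharP K p] :
    ∃ v : V, ∀ l : V →ₗ[F] F, (∀ u ∈ unipotentSubgroup n K, ∀ x, l (ρ u x) = l x) →
      l v = 0 → l = 0 := by
  cases nonempty_fintype K
  obtain ⟨v, hv0, hv, hT, hs⟩ := exists_weight_vector (ρ := ρ) p
  refine ⟨ρ (perm Fin.revPerm) v, fun l hl hlv => ?_⟩
  -- Conjugation by w₀ takes U⁻ to U, so l(w₀uv) = l(w₀v) = 0 for u in U⁻, and such uv span V.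
  have h1 : l ∘ₗ ρ (perm Fin.revPerm) = 0 := by
    refine LinearMap.ext_on_range (span_lower_eq_top hv0 hv hT hs) fun u => ?_
    have h2 := hl _ (mem_unip_iff_conj.1 u.2) (ρ (perm Fin.revPerm) v)
    rw [← Module.End.mul_apply, ← map_mul, inv_mul_cancel_right, hlv, map_mul,
      Module.End.mul_apply] at h2
    exact h2
  ext x
  have h2 := LinearMap.congr_fun h1 (ρ (perm Fin.revPerm)⁻¹ x)
  rwa [LinearMap.comp_apply, ← Module.End.mul_apply, ← map_mul, mul_inv_cancel, map_one] at h2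

end DefiningCharacteristic

/-! ### Permutations whose descents all have height one -/

section Combinatorics

variable {n : ℕ} {α : Type*} {τ : Perm (Fin n)} {d : Fin n → α}

/-- A permutation all of whose descents have height one satisfies `τ p + p = τ j + j` for each
inversion `(j, p)`. -/
theorem add_eq_add_of_inversion
    (h : ∀ j k : Fin n, (j : ℕ) + 1 = k → τ k < τ j → (τ k : ℕ) + 1 = τ j ∧ d k = d j)
    {j p : Fin n} (hjp : j < p) (hτ : τ p < τ j) : (τ p : ℕ) + p = τ j + j ∧ d p = d j := by
  have hne : ∀ {a b : Fin n}, (a : ℕ) ≠ b → (τ a : ℕ) ≠ τ b := fun hab h' =>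
    hab (congrArg Fin.val (τ.injective (Fin.ext h')))
  obtain ⟨m, hm⟩ : ∃ m : ℕ, (p : ℕ) = j + 1 + m := ⟨p - (j + 1), by rw [Fin.lt_def] at hjp; omega⟩
  induction m generalizing j with
  | zero =>
    obtain ⟨h1, h2⟩ := h j p hm.symm hτ
    exact ⟨by omega, h2⟩
  | succ m ih =>
    have hk : (j : ℕ) + 1 < n := by omega
    set k : Fin n := ⟨j + 1, hk⟩ with hkdef
    have hkp : k < p := by rw [Fin.lt_def]; simp only [hkdef]; omega
    have hkj : (k : ℕ) = j + 1 := rfl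
    rcases lt_or_gt_of_ne (hne (a := k) (b := j) (by omega)) with hlt | hgt
    · obtain ⟨h1, h2⟩ := h j k rfl hlt
      have := hne (a := p) (b := k) (by omega)
      rw [Fin.lt_def] at hτ
      obtain ⟨h3, h4⟩ := ih hkp (by rw [Fin.lt_def]; omega) (by omega)
      exact ⟨by omega, h4.trans h2⟩
    -- After an ascent at j the values stay above τ j: they fall by at most one per step, so they
    -- would have to take the value τ j again.
    · exfalso
      have hall : ∀ m : ℕ, ∀ q : Fin n, (q : ℕ) = j + 1 + m → τ j < τ q := by
        intro m
        induction m with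
        | zero => intro q hq; rwa [show q = k from Fin.ext hq]
        | succ m ihm =>
          intro q hq
          have h1 := ihm ⟨j + 1 + m, by omega⟩ rfl
          have h2 := hne (a := q) (b := j) (by omega)
          have h3 := h ⟨j + 1 + m, by omega⟩ q (by simp only; omega)
          rw [Fin.lt_def] at h1 h3 ⊢
          by_contra h4
          have := (h3 (by omega)).1
          omega
      exact lt_asymm hτ (hall _ p hm)

/-- Let τ p = j. If (j, p) or (p, j) is an inversion, `add_eq_add_of_inversion` gives p = τ j.
Otherwise pigeonhole yields r on the other side of j from τ j and p or from τ r, forming inversions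
with both j and p; comparing the two sums again gives p = τ j, contradicting the order. -/
theorem involutive_of_descents
    (h : ∀ j k : Fin n, (j : ℕ) + 1 = k → τ k < τ j → (τ k : ℕ) + 1 = τ j ∧ d k = d j)
    (j : Fin n) : τ (τ j) = j ∧ d (τ j) = d j := by
  have pigeon : ∀ s : Set (Fin n), j ∉ s → τ j ∈ s → ∃ r ∈ s, τ r ∉ s := by
    intro s hj hτj
    by_contra! hs
    have := Equiv.Perm.perm_symm_mapsTo_of_mapsTo τ hs hτj
    rw [symm_apply_apply] at this
    exact hj this
  have key : τ (τ j) = j := by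
    obtain ⟨p, hp⟩ := τ.surjective j
    suffices p = τ j by rw [← this, hp]
    have hp' : (τ p : ℕ) = j := congrArg Fin.val hp
    have hne : ∀ r, r ≠ p → (τ r : ℕ) ≠ j := fun r hr h' =>
      hr (τ.injective ((Fin.ext h').trans hp.symm))
    rcases lt_trichotomy j p with hjp | rfl | hjp
    · rcases lt_trichotomy j (τ j) with hj | hj | hj
      · have := (add_eq_add_of_inversion h hjp (by rwa [hp])).1
        exact Fin.ext (by omega)
      · exact absurd (congrArg Fin.val hj.symm) (hne j hjp.ne)
      · obtain ⟨r, hr, hτr⟩ := pigeon {r | r < j} (lt_irrefl j) hj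
        simp only [Set.mem_ofPred_eq, Fin.lt_def, not_lt] at hr hτr hj hjp
        have h1 := hne r (by rintro rfl; omega)
        have h2 := (add_eq_add_of_inversion h (j := r) (p := p)
          (by rw [Fin.lt_def]; omega) (by rw [Fin.lt_def]; omega)).1
        have h3 := (add_eq_add_of_inversion h (j := r) (p := j)
          (by rw [Fin.lt_def]; omega) (by rw [Fin.lt_def]; omega)).1
        omega
    · exact hp.symm
    · rcases lt_trichotomy j (τ j) with hj | hj | hj
      · obtain ⟨r, hr, hτr⟩ := pigeon {r | j < r} (lt_irrefl j) hj
        simp only [Set.mem_ofPred_eq, Fin.lt_def, not_lt] at hr hτr hj hjp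
        have h1 := hne r (by rintro rfl; omega)
        have h2 := (add_eq_add_of_inversion h (j := p) (p := r)
          (by rw [Fin.lt_def]; omega) (by rw [Fin.lt_def]; omega)).1
        have h3 := (add_eq_add_of_inversion h (j := j) (p := r)
          (by rw [Fin.lt_def]; omega) (by rw [Fin.lt_def]; omega)).1
        omega
      · exact absurd (congrArg Fin.val hj.symm) (hne j hjp.ne')
      · have := (add_eq_add_of_inversion h hjp (by rwa [hp])).1
        exact Fin.ext (by omega)
  refine ⟨key, ?_⟩
  rcases lt_trichotomy j (τ j) with hj | hj | hj
  · exact (add_eq_add_of_inversion h hj (by rwa [key])).2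
  · rw [← hj]
  · exact (add_eq_add_of_inversion h hj (by rwa [key])).2.symm

end Combinatorics

/-! ### Transposition along the antidiagonal -/

section Antitranspose

variable {n : ℕ} {K : Type*} [Field K]

/-- Transposition along the antidiagonal. -/
def antitranspose (g : GL (Fin n) K) : GL (Fin n) K where
  val := (g.val.submatrix Fin.revPerm Fin.revPerm).transpose
  inv := (g⁻¹.val.submatrix Fin.revPerm Fin.revPerm).transpose
  val_inv := by
    rw [← Matrix.transpose_mul, Matrix.submatrix_mul_equiv, ← Units.val_mul]
    simp
  inv_val := by
    rw [← Matrix.transpose_mul, Matrix.submatrix_mul_equiv, ← Units.val_mul]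
    simp

theorem antitranspose_apply (g : GL (Fin n) K) (a b : Fin n) :
    antitranspose g a b = g b.rev a.rev := rfl

theorem antitranspose_mul (g h : GL (Fin n) K) :
    antitranspose (g * h) = antitranspose h * antitranspose g := by
  apply Units.ext
  change ((g * h).val.submatrix Fin.revPerm Fin.revPerm).transpose =
    (h.val.submatrix Fin.revPerm Fin.revPerm).transpose * (g.val.submatrix Fin.revPerm Fin.revPerm).transpose
  rw [← Matrix.transpose_mul, Matrix.submatrix_mul_equiv, Units.val_mul]

theorem antitranspose_antitranspose (g : GL (Fin n) K) :
    antitranspose (antitranspose g) = g := by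
  ext a b
  simp [antitranspose_apply]

theorem antitranspose_mem {u : GL (Fin n) K} (hu : u ∈ unipotentSubgroup n K) :
    antitranspose u ∈ unipotentSubgroup n K :=
  ⟨fun _ _ hab => hu.1 _ _ (Fin.rev_lt_rev.2 hab), fun _ => hu.2 _⟩

theorem superdiagonalSum_eq (g : GL (Fin n) K) :
    superdiagonalSum g = ∑ i : Fin n, ∑ j : Fin n, if (i : ℕ) + 1 = j then g i j else 0 := by
  refine Finset.sum_congr rfl fun i _ => ?_
  split_ifs with h
  · rw [Finset.sum_eq_single (⟨i + 1, h⟩ : Fin n)]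
    · simp
    · intro j _ hj
      rw [if_neg fun h' => hj (Fin.ext h'.symm)]
    · simp
  · refine (Finset.sum_eq_zero fun j _ => if_neg ?_).symm
    omega

theorem superdiagonalSum_antitranspose (g : GL (Fin n) K) :
    superdiagonalSum (antitranspose g) = superdiagonalSum g := by
  rw [superdiagonalSum_eq, superdiagonalSum_eq, Finset.sum_comm]
  refine Fintype.sum_equiv Fin.revPerm _ _ fun i => Fintype.sum_equiv Fin.revPerm _ _ fun j => ?_
  rw [antitranspose_apply, Fin.revPerm_apply, Fin.revPerm_apply]
  have : (j : ℕ) + 1 = i ↔ (i.rev : ℕ) + 1 = j.rev := by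
    rw [Fin.val_rev, Fin.val_rev]; omega
  simp only [this]

theorem superdiagonalSum_elementary {i j : Fin n} (h : i ≠ j) (a : K) :
    superdiagonalSum (elementary h a) = if (i : ℕ) + 1 = j then a else 0 := by
  rw [superdiagonalSum_eq, Finset.sum_eq_single i, Finset.sum_eq_single j]
  · simp [elementary_apply, h]
  · intro b _ hb
    by_cases hib : i = b
    · subst hib; simp
    · simp [elementary_apply, hb, hib]
  · simp
  · intro b _ hb
    refine Finset.sum_eq_zero fun c _ => ?_
    by_cases hbc : b = c
    · subst hbc; simp
    · simp [elementary_apply, hb, hbc]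
  · simp

/-- With τ = rev ∘ σ, the matrix is fixed exactly when τ² = 1 and d ∘ τ = d; ascents of σ are
descents of τ. -/
theorem antitranspose_monomial {σ : Perm (Fin n)} {d : Fin n → Kˣ}
    (h : ∀ j k : Fin n, (j : ℕ) + 1 = k → σ j < σ k → (σ j : ℕ) + 1 = σ k ∧ d k = d j) :
    antitranspose (monomial σ d) = monomial σ d := by
  have hτ := involutive_of_descents (τ := Fin.revPerm * σ) (d := d) (by
    intro j k hjk hlt
    simp only [Perm.mul_apply, Fin.revPerm_apply, Fin.rev_lt_rev, Fin.val_rev] at hlt ⊢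
    obtain ⟨h1, h2⟩ := h j k hjk hlt
    exact ⟨by omega, h2⟩)
  ext a b
  rw [antitranspose_apply, monomial_apply, monomial_apply]
  have h1 := (hτ b).1
  have h2 := (hτ b).2
  simp only [Perm.mul_apply, Fin.revPerm_apply] at h1 h2
  by_cases hab : a = σ b
  · subst hab
    rw [if_pos rfl, h2, if_pos]
    rw [← h1, Fin.rev_rev, h1]
  · rw [if_neg hab, if_neg]
    intro h3
    apply hab
    have h4 := (hτ a.rev).1
    simp only [Perm.mul_apply, Fin.revPerm_apply, ← h3, Fin.rev_rev] at h4
    rw [← Fin.rev_rev a, ← h4, Fin.rev_rev]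

end Antitranspose

/-! ### Nondefining characteristic: Gelfand's trick -/

section NondefiningCharacteristic

variable {n : ℕ} {F K V : Type*} [Field F] [Field K] [AddCommGroup V] [Module F V]
  (ρ : Representation F (GL (Fin n) K) V) (ψ : AddChar K F)

theorem whittakerCharacter_apply (u : unipotentSubgroup n K) :
    whittakerCharacter n ψ u = ψ (superdiagonalSum (u : GL (Fin n) K)) := rfl

theorem whittakerCharacter_inv_mul (u : unipotentSubgroup n K) :
    whittakerCharacter n ψ u⁻¹ * whittakerCharacter n ψ u = 1 := by
  rw [← map_mul, inv_mul_cancel, map_one]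

/-- The restriction of `antitranspose` to the unipotent subgroup. -/
def antitransposeEquiv : unipotentSubgroup n K ≃ unipotentSubgroup n K where
  toFun u := ⟨antitranspose u, antitranspose_mem u.2⟩
  invFun u := ⟨antitranspose u, antitranspose_mem u.2⟩
  left_inv _ := Subtype.ext (antitranspose_antitranspose _)
  right_inv _ := Subtype.ext (antitranspose_antitranspose _)

theorem coe_antitransposeEquiv (u : unipotentSubgroup n K) :
    (antitransposeEquiv u : GL (Fin n) K) = antitranspose u := rfl

theorem whittakerCharacter_antitransposeEquiv (u : unipotentSubgroup n K) :
    whittakerCharacter n ψ (antitransposeEquiv u) = whittakerCharacter n ψ u := by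
  rw [whittakerCharacter_apply, coe_antitransposeEquiv, superdiagonalSum_antitranspose,
    whittakerCharacter_apply]

theorem whittakerCharacter_inv_eq (u : unipotentSubgroup n K) :
    whittakerCharacter n ψ u⁻¹ = (whittakerCharacter n ψ u)⁻¹ :=
  eq_inv_of_mul_eq_one_left (whittakerCharacter_inv_mul ψ u)

/-- Either a monomial matrix is fixed by `antitranspose`, or it intertwines two unipotent elements
on which the Whittaker character takes different values. -/
theorem antitranspose_monomial_or (hψ : ψ ≠ 1) (σ : Perm (Fin n)) (d : Fin n → Kˣ) :
    antitranspose (monomial σ d) = monomial σ d ∨ ∃ u u' : unipotentSubgroup n K,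
      monomial σ d * u = u' * monomial σ d ∧
        whittakerCharacter n ψ u ≠ whittakerCharacter n ψ u' := by
  by_cases h : ∀ j k : Fin n, (j : ℕ) + 1 = k → σ j < σ k →
      (σ j : ℕ) + 1 = σ k ∧ d k = d j
  · exact Or.inl (antitranspose_monomial h)
  push Not at h
  obtain ⟨j, k, hjk, hσ, hd⟩ := h
  have hlt : j < k := by rw [Fin.lt_def]; omega
  obtain ⟨a₀, ha₀⟩ := AddChar.ne_one_iff.1 hψ
  obtain ⟨a, ha⟩ : ∃ a : K, ψ a ≠
      ψ (if (σ j : ℕ) + 1 = σ k then d j * a * ((d k)⁻¹ : Kˣ) else 0) := by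
    by_cases hσ' : (σ j : ℕ) + 1 = σ k
    · have hd' : (1 - d j * ((d k)⁻¹ : Kˣ) : K) ≠ 0 := by
        intro h0
        apply hd hσ'
        rw [sub_eq_zero, ← Units.val_mul, ← Units.val_one, Units.val_inj, eq_comm,
          mul_inv_eq_one] at h0
        exact h0.symm
      -- Chosen so that a - d_j a d_k⁻¹ = a₀; equal values of ψ would then force ψ(a₀) = 1.
      refine ⟨a₀ / (1 - d j * ((d k)⁻¹ : Kˣ)), fun h0 => ha₀ ?_⟩
      set b := a₀ / (1 - d j * ((d k)⁻¹ : Kˣ) : K) with hb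
      have h1 : a₀ + d j * b * ((d k)⁻¹ : Kˣ) = b := by
        have : b * (1 - d j * ((d k)⁻¹ : Kˣ) : K) = a₀ := div_mul_cancel₀ _ hd'
        rw [← this]; ring
      rw [if_pos hσ'] at h0
      have h2 := AddChar.map_add_eq_mul ψ a₀ (d j * b * ((d k)⁻¹ : Kˣ))
      rw [h1, ← h0] at h2
      have h3 : ψ b ≠ 0 := by
        have := AddChar.map_add_eq_mul ψ b (-b)
        rw [add_neg_cancel, AddChar.map_zero_eq_one] at this
        exact left_ne_zero_of_mul (this ▸ one_ne_zero)
      exact (mul_eq_right₀ h3).1 h2.symm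
    · exact ⟨a₀, by rwa [if_neg hσ', AddChar.map_zero_eq_one]⟩
  have hm1 : elementary hlt.ne a ∈ unipotentSubgroup n K := by
    rw [← unip_one]; exact elementary_mem_unip _ hlt _
  have hm2 : elementary (σ.injective.ne hlt.ne) (d j * a * ((d k)⁻¹ : Kˣ) : K) ∈
      unipotentSubgroup n K := by
    rw [← unip_one]; exact elementary_mem_unip (w := 1) _ hσ _
  refine Or.inr ⟨⟨_, hm1⟩, ⟨_, hm2⟩, monomial_mul_elementary hlt.ne σ d a, ?_⟩
  rwa [whittakerCharacter_apply, whittakerCharacter_apply, superdiagonalSum_elementary,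
    superdiagonalSum_elementary, if_pos hjk]

variable [Fintype (unipotentSubgroup n K)]

/-- The projector onto the `η_ψ`-isotypic part, multiplied by the order of `U`. -/
def whittakerProjector : Module.End F V :=
  ∑ u : unipotentSubgroup n K, whittakerCharacter n ψ u⁻¹ • ρ u

/-- The action of the element of the Hecke algebra attached to `g`. -/
def heckeOperator (g : GL (Fin n) K) : Module.End F V :=
  whittakerProjector ρ ψ * ρ g * whittakerProjector ρ ψ

theorem apply_mul_whittakerProjector (u : unipotentSubgroup n K) :
    ρ u * whittakerProjector ρ ψ = whittakerCharacter n ψ u • whittakerProjector ρ ψ := by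
  rw [whittakerProjector, Finset.mul_sum, Finset.smul_sum]
  refine Fintype.sum_equiv (Equiv.mulLeft u) _ _ fun v => ?_
  rw [Equiv.coe_mulLeft, smul_smul, mul_inv_rev, map_mul, mul_left_comm,
    mul_comm (whittakerCharacter n ψ u), whittakerCharacter_inv_mul, mul_one, mul_smul_comm, ← map_mul ρ, Subgroup.coe_mul]

theorem whittakerProjector_mul_apply (u : unipotentSubgroup n K) :
    whittakerProjector ρ ψ * ρ u = whittakerCharacter n ψ u • whittakerProjector ρ ψ := by
  rw [whittakerProjector, Finset.sum_mul, Finset.smul_sum]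
  refine Fintype.sum_equiv (Equiv.mulRight u) _ _ fun v => ?_
  rw [Equiv.coe_mulRight, smul_smul, ← map_mul, mul_inv_rev, mul_inv_cancel_left, smul_mul_assoc,
    ← map_mul ρ, Subgroup.coe_mul]

theorem whittakerProjector_mul_self : whittakerProjector ρ ψ * whittakerProjector ρ ψ =
    (Fintype.card (unipotentSubgroup n K) : F) • whittakerProjector ρ ψ := by
  conv_lhs => enter [1]; rw [whittakerProjector]
  simp only [Finset.sum_mul, smul_mul_assoc, apply_mul_whittakerProjector, smul_smul,
    whittakerCharacter_inv_mul, one_smul, Finset.sum_const, Finset.card_univ, Nat.cast_smul_eq_nsmul]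

theorem heckeOperator_mul_left (u : unipotentSubgroup n K) (g : GL (Fin n) K) :
    heckeOperator ρ ψ (u * g) = whittakerCharacter n ψ u • heckeOperator ρ ψ g := by
  rw [heckeOperator, map_mul, ← mul_assoc, whittakerProjector_mul_apply, smul_mul_assoc,
    smul_mul_assoc, heckeOperator]

theorem heckeOperator_mul_right (u : unipotentSubgroup n K) (g : GL (Fin n) K) :
    heckeOperator ρ ψ (g * u) = whittakerCharacter n ψ u • heckeOperator ρ ψ g := by
  rw [heckeOperator, map_mul, mul_assoc, mul_assoc, apply_mul_whittakerProjector, mul_smul_comm,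
    mul_smul_comm, heckeOperator, mul_assoc]

theorem heckeOperator_mul_heckeOperator (g h : GL (Fin n) K) :
    heckeOperator ρ ψ g * heckeOperator ρ ψ h =
      (Fintype.card (unipotentSubgroup n K) : F) • ∑ u : unipotentSubgroup n K,
        whittakerCharacter n ψ u⁻¹ • heckeOperator ρ ψ (g * u * h) := by
  have h1 : heckeOperator ρ ψ g * heckeOperator ρ ψ h = whittakerProjector ρ ψ * ρ g *
      (whittakerProjector ρ ψ * whittakerProjector ρ ψ) * ρ h * whittakerProjector ρ ψ := by
    simp only [heckeOperator, mul_assoc]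
  rw [h1, whittakerProjector_mul_self, mul_smul_comm, smul_mul_assoc, smul_mul_assoc]
  congr 1
  conv_lhs => enter [1, 1, 2]; rw [whittakerProjector]
  simp only [Finset.mul_sum, Finset.sum_mul, mul_smul_comm, smul_mul_assoc, heckeOperator, map_mul,
    mul_assoc]

/-- Both sides transform alike under U on either side, so by Bruhat g may be taken monomial. If it
is not fixed, two different character values kill PgP, and the antitransposed relation kills the
other side. -/
theorem heckeOperator_antitranspose (hψ : ψ ≠ 1) (g : GL (Fin n) K) :
    heckeOperator ρ ψ (antitranspose g) = heckeOperator ρ ψ g := by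
  obtain ⟨u, hu, σ, d, u', hu', rfl⟩ := exists_unip_mul_monomial_mul_unip g
  lift u to unipotentSubgroup n K using hu
  lift u' to unipotentSubgroup n K using hu'
  rw [antitranspose_mul, antitranspose_mul, ← coe_antitransposeEquiv, ← coe_antitransposeEquiv,
    heckeOperator_mul_left, heckeOperator_mul_right, heckeOperator_mul_right,
    heckeOperator_mul_left, whittakerCharacter_antitransposeEquiv,
    whittakerCharacter_antitransposeEquiv]
  congr 2
  rcases antitranspose_monomial_or ψ hψ σ d with h | ⟨v, v', hv, hne⟩
  · rw [h]
  · have h1 : heckeOperator ρ ψ (monomial σ d) = 0 := by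
      have h2 := heckeOperator_mul_left ρ ψ v' (monomial σ d)
      rw [← hv, heckeOperator_mul_right, ← sub_eq_zero, ← sub_smul] at h2
      exact (smul_eq_zero.1 h2).resolve_left (sub_ne_zero.2 hne)
    have h2 := congrArg antitranspose hv
    rw [antitranspose_mul, antitranspose_mul, ← coe_antitransposeEquiv,
      ← coe_antitransposeEquiv] at h2
    have h3 := heckeOperator_mul_left ρ ψ (antitransposeEquiv v) (antitranspose (monomial σ d))
    rw [h2, heckeOperator_mul_right, whittakerCharacter_antitransposeEquiv,
      whittakerCharacter_antitransposeEquiv, ← sub_eq_zero, ← sub_smul] at h3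
    rw [h1, (smul_eq_zero.1 h3).resolve_left (sub_ne_zero.2 hne.symm)]

/-- The product formula expresses both products as sums over U, and antitransposition reverses g u h
while preserving the character. -/
theorem heckeOperator_comm (hψ : ψ ≠ 1) (g h : GL (Fin n) K) :
    heckeOperator ρ ψ g * heckeOperator ρ ψ h = heckeOperator ρ ψ h * heckeOperator ρ ψ g := by
  rw [← heckeOperator_antitranspose ρ ψ hψ h, ← heckeOperator_antitranspose ρ ψ hψ g,
    heckeOperator_mul_heckeOperator ρ ψ (antitranspose h), heckeOperator_antitranspose ρ ψ hψ h,
    heckeOperator_antitranspose ρ ψ hψ g, heckeOperator_mul_heckeOperator]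
  congr 1
  refine Fintype.sum_equiv antitransposeEquiv _ _ fun u => ?_
  rw [coe_antitransposeEquiv, mul_assoc (antitranspose h), ← antitranspose_mul,
    ← antitranspose_mul, heckeOperator_antitranspose ρ ψ hψ, whittakerCharacter_inv_eq,
    whittakerCharacter_inv_eq, whittakerCharacter_antitransposeEquiv]

variable {ρ ψ}

theorem exists_vector_of_ne_one [IsAlgClosed F] [Finite K] [ρ.IsIrreducible] (hψ : ψ ≠ 1)
    (hU : (Fintype.card (unipotentSubgroup n K) : F) ≠ 0) :
    ∃ v : V, ∀ l : V →ₗ[F] F,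
      (∀ (u : unipotentSubgroup n K) x, l (ρ u x) = whittakerCharacter n ψ u * l x) →
      l v = 0 → l = 0 := by
  have := finiteDimensional_of_isIrreducible ρ
  set N : F := (Fintype.card (unipotentSubgroup n K) : F) with hN
  have hlP : ∀ l : V →ₗ[F] F,
      (∀ (u : unipotentSubgroup n K) x, l (ρ u x) = whittakerCharacter n ψ u * l x) →
      ∀ x, l (whittakerProjector ρ ψ x) = N * l x := fun l hl x => by
    simp only [whittakerProjector, LinearMap.sum_apply, LinearMap.smul_apply, map_sum, map_smul,
      hl, smul_eq_mul, ← mul_assoc, whittakerCharacter_inv_mul, one_mul, Finset.sum_const,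
      Finset.card_univ, nsmul_eq_mul, hN]
  by_cases hP : LinearMap.range (whittakerProjector ρ ψ) = ⊥
  · refine ⟨0, fun l hl _ => LinearMap.ext fun x => ?_⟩
    have h := hlP l hl x
    rw [LinearMap.range_eq_bot.1 hP, LinearMap.zero_apply, map_zero] at h
    exact (mul_eq_zero.1 h.symm).resolve_left hU
  · obtain ⟨v, ⟨y, rfl⟩, hv0, hc⟩ := exists_common_eigenvector (heckeOperator ρ ψ)
      (fun g h v => LinearMap.congr_fun (heckeOperator_comm ρ ψ hψ g h) v) _ hP
      (fun g x _ => ⟨_, rfl⟩)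
    refine ⟨whittakerProjector ρ ψ y, fun l hl hlv =>
      LinearMap.ext_on_range (span_orbit_eq_top ρ hv0) fun g => ?_⟩
    obtain ⟨c, hc⟩ := hc g
    have h1 := congrArg l hc
    have h2 : whittakerProjector ρ ψ (whittakerProjector ρ ψ y) =
        N • whittakerProjector ρ ψ y :=
      LinearMap.congr_fun (whittakerProjector_mul_self ρ ψ) y
    -- Applying l to PgPv = cv gives N² l(gv) = c l(v) = 0, where N = |U| is nonzero in F.
    rw [heckeOperator, Module.End.mul_apply, Module.End.mul_apply, h2, hlP l hl, map_smul,
      map_smul, map_smul, hlv, smul_zero, smul_eq_mul] at h1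
    exact ((mul_eq_zero.1 h1).resolve_left hU |> mul_eq_zero.1).resolve_left hU

end NondefiningCharacteristic

/-! ### Frobenius reciprocity and uniqueness of models -/

section
variable {n : ℕ} {F K V : Type*} [Field F] [Field K] [AddCommGroup V] [Module F V]
  {ρ : Representation F (GL (Fin n) K) V} {ψ : AddChar K F}

theorem coe_apply_unipotent (x : Representation.coindV (unipotentSubgroup n K).subtype
    (characterRepresentation (whittakerCharacter n ψ))) (u : unipotentSubgroup n K)
    (g : GL (Fin n) K) : x.1 (u * g) = whittakerCharacter n ψ u * x.1 g := x.2 u g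

theorem coe_apply_intertwining (f : Representation.IntertwiningMap ρ (gelfandGraev n ψ))
    (g : GL (Fin n) K) (x : V) : (f (ρ g x)).1 1 = (f x).1 g := by
  rw [f.isIntertwining]
  change (f x).1 (1 * g) = _
  rw [one_mul]

/-- The functional attached to an intertwining map by Frobenius reciprocity. -/
def whittakerFunctional (f : Representation.IntertwiningMap ρ (gelfandGraev n ψ)) : V →ₗ[F] F :=
  LinearMap.proj 1 ∘ₗ Submodule.subtype _ ∘ₗ f.toLinearMap

theorem whittakerFunctional_apply (f : Representation.IntertwiningMap ρ (gelfandGraev n ψ))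
    (x : V) : whittakerFunctional f x = (f x).1 1 := rfl

theorem whittakerFunctional_unipotent
    (f : Representation.IntertwiningMap ρ (gelfandGraev n ψ)) (u : unipotentSubgroup n K) (x : V) :
    whittakerFunctional f (ρ u x) = whittakerCharacter n ψ u * whittakerFunctional f x := by
  rw [whittakerFunctional_apply, whittakerFunctional_apply, coe_apply_intertwining,
    ← coe_apply_unipotent, mul_one]

theorem whittakerFunctional_injective : Function.Injective
    (whittakerFunctional : Representation.IntertwiningMap ρ (gelfandGraev n ψ) → V →ₗ[F] F) := by
  intro f f' h
  refine DFunLike.ext _ _ fun x => Subtype.ext (funext fun g => ?_)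
  exact (coe_apply_intertwining f g x).symm.trans
    ((LinearMap.congr_fun h (ρ g x)).trans (coe_apply_intertwining f' g x))

/-- The vector `v` separates the functionals on which `U` acts through the Whittaker character. -/
def IsWhittakerSeparating (ρ : Representation F (GL (Fin n) K) V) (ψ : AddChar K F) (v : V) :
    Prop :=
  ∀ l : V →ₗ[F] F,
    (∀ (u : unipotentSubgroup n K) x, l (ρ u x) = whittakerCharacter n ψ u * l x) →
    l v = 0 → l = 0

theorem exists_smul_eq_intertwiningMap {v : V} (hv : IsWhittakerSeparating ρ ψ v) :
    ∃ f₀ : Representation.IntertwiningMap ρ (gelfandGraev n ψ), ∀ f, ∃ r : F, r • f₀ = f := by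
  have key : ∀ (f f' : Representation.IntertwiningMap ρ (gelfandGraev n ψ)) (r : F),
      r * whittakerFunctional f v = whittakerFunctional f' v → r • f = f' := fun f f' r h => by
    apply whittakerFunctional_injective
    rw [← sub_eq_zero]
    refine hv _ (fun u x => ?_) ?_
    · have h1 := whittakerFunctional_unipotent f u x
      have h2 := whittakerFunctional_unipotent f' u x
      change r * whittakerFunctional f (ρ u x) - whittakerFunctional f' (ρ u x) =
        _ * (r * whittakerFunctional f x - whittakerFunctional f' x)
      rw [h1, h2]; ring
    · change r * whittakerFunctional f v - whittakerFunctional f' v = 0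
      rw [h, sub_self]
  by_cases h : ∃ f : Representation.IntertwiningMap ρ (gelfandGraev n ψ),
      whittakerFunctional f v ≠ 0
  · obtain ⟨f, hf⟩ := h
    exact ⟨f, fun g => ⟨whittakerFunctional g v / whittakerFunctional f v,
      key _ _ _ (div_mul_cancel₀ _ hf)⟩⟩
  · push Not at h
    exact ⟨0, fun g => ⟨0, key _ _ _ (by rw [h g, zero_mul])⟩⟩

theorem rank_intertwiningMap_le_one {v : V} (hv : IsWhittakerSeparating ρ ψ v) :
    Module.rank F (Representation.IntertwiningMap ρ (gelfandGraev n ψ)) ≤ 1 := by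
  obtain ⟨f₀, hf₀⟩ := exists_smul_eq_intertwiningMap hv
  have h := LinearMap.lift_rank_le_of_surjective (LinearMap.toSpanSingleton F _ f₀) hf₀
  rw [Module.rank_self] at h
  simpa using h

/-- The embedding defining a model is r f₀ with r ≠ 0, so its image is that of f₀. -/
theorem subsingleton_isWhittakerModel [ρ.IsIrreducible] {v : V}
    (hv : IsWhittakerSeparating ρ ψ v) :
    {W : Subrepresentation (gelfandGraev n ψ) | IsWhittakerModel ρ ψ W}.Subsingleton := by
  obtain ⟨f₀, hf₀⟩ := exists_smul_eq_intertwiningMap hv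
  have := nontrivial_of_isIrreducible ρ
  suffices ∀ W : Subrepresentation (gelfandGraev n ψ), IsWhittakerModel ρ ψ W →
      W = f₀.range from fun W hW W' hW' => (this W hW).trans (this W' hW').symm
  rintro W ⟨e⟩
  let f : Representation.IntertwiningMap ρ (gelfandGraev n ψ) :=
    { toLinearMap := W.toSubmodule.subtype ∘ₗ e.toLinearMap
      isIntertwining' := fun g => LinearMap.ext fun x =>
        congrArg Subtype.val (LinearMap.congr_fun (e.toIntertwiningMap.isIntertwining' g) x) }
  have hf : ∀ x, f x = (e x : W.toSubmodule).1 := fun x => rfl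
  obtain ⟨r, hr⟩ := hf₀ f
  have hr' : ∀ x, r • f₀ x = f x := fun x => by rw [← hr]; rfl
  have hr0 : r ≠ 0 := by
    rintro rfl
    obtain ⟨x, hx⟩ := exists_ne (0 : V)
    have h1 := hr' x
    rw [zero_smul, hf] at h1
    exact hx (e.toLinearEquiv.map_eq_zero_iff.1 (Subtype.ext h1.symm))
  apply SetLike.ext
  intro y
  rw [Representation.IntertwiningMap.mem_range]
  constructor
  · intro hy
    obtain ⟨x, hx⟩ := e.toLinearEquiv.surjective ⟨y, hy⟩
    refine ⟨r • x, ?_⟩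
    rw [map_smul, hr', hf]
    exact congrArg Subtype.val hx
  · rintro ⟨x, rfl⟩
    have h1 : f (r⁻¹ • x) = f₀ x := by
      rw [← hr', map_smul, smul_inv_smul₀ hr0]
    rw [← h1]
    exact (e (r⁻¹ • x)).2

/-- In characteristic p, ψ(x)^p = 1 gives (ψ(x) - 1)^p = 0. -/
theorem addChar_eq_one_of_charP (p : ℕ) [Fact p.Prime] [CharP F p] [CharP K p]
    (ψ : AddChar K F) : ψ = 1 := by
  ext x
  have h : ψ x ^ p = 1 := by
    rw [← AddChar.map_nsmul_eq_pow, nsmul_eq_mul, CharP.cast_eq_zero, zero_mul,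
      AddChar.map_zero_eq_one]
  rw [← sub_eq_zero, AddChar.one_apply]
  refine pow_eq_zero_iff (Fact.out : p.Prime).ne_zero |>.1 ?_
  rw [sub_pow_char, h, one_pow, sub_self]

theorem exists_whittaker_vector [IsAlgClosed F] [Finite K] [ρ.IsIrreducible]
    (hψ : ¬ ringChar F ∣ Nat.card K → ψ ≠ 1) :
    ∃ v : V, IsWhittakerSeparating ρ ψ v := by
  cases nonempty_fintype K
  obtain ⟨p, hKp⟩ := CharP.exists K
  obtain ⟨m, hp, hm⟩ := FiniteField.card K p
  have := Fact.mk hp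
  rw [Nat.card_eq_fintype_card, hm] at hψ
  by_cases hdvd : ringChar F ∣ p ^ (m : ℕ)
  · have hF : ringChar F = p := by
      rcases CharP.char_is_prime_or_zero F (ringChar F) with h | h
      · exact (Nat.prime_dvd_prime_iff_eq h hp).1 (h.dvd_of_dvd_pow hdvd)
      · rw [h, zero_dvd_iff] at hdvd
        exact absurd hdvd (pow_ne_zero _ hp.ne_zero)
    have : CharP F p := ringChar.of_eq hF
    obtain ⟨v, hv⟩ := exists_vector_of_charP (ρ := ρ) p
    refine ⟨v, fun l hl => hv l fun u hu x => ?_⟩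
    rw [hl ⟨u, hu⟩ x, whittakerCharacter_apply, addChar_eq_one_of_charP p ψ, AddChar.one_apply,
      one_mul]
  · have := Fintype.ofFinite (unipotentSubgroup n K)
    refine exists_vector_of_ne_one (hψ hdvd) ?_
    obtain ⟨e, he⟩ := (IsPGroup.iff_card (p := p)).1 (isPGroup_unipotentSubgroup n K p)
    rw [← Nat.card_eq_fintype_card, he, Nat.cast_pow]
    refine pow_ne_zero _ fun h => hdvd ?_
    exact ((ringChar.spec F p).1 h).trans (dvd_pow_self p m.ne_zero)

end

end GLWhittaker
end

theorem mainTheorem5 {k F K V : Type*} [Field k] [Finite k] [Field F] [Algebra k F]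
    [IsAlgClosure k F] [Field K] [Finite K] (n : ℕ) (ψ : AddChar K F)
    (hψ : ¬ ringChar F ∣ Nat.card K → ψ ≠ 1)
    [AddCommGroup V] [Module F V] (π : Representation F (GL (Fin n) K) V)
    [π.IsIrreducible] :
    Module.rank F (Representation.IntertwiningMap π (gelfandGraev n ψ)) ≤ 1 ∧
      {W : Subrepresentation (gelfandGraev n ψ) | IsWhittakerModel π ψ W}.Subsingleton := by
  have : IsAlgClosed F := IsAlgClosure.isAlgClosed k
  obtain ⟨v, hv⟩ := GLWhittaker.exists_whittaker_vector (ρ := π) hψ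
  exact ⟨GLWhittaker.rank_intertwiningMap_le_one hv, GLWhittaker.subsingleton_isWhittakerModel hv⟩
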